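/- Let $G=(V,E)$ be a finite simple graph and let $M$ be a matching in $G$. A vertex is unmatched if no edge of $M$ covers it. An alternating path is a simple path (possibly of length $0$) whose edges alternate between edges in $M$ and edges not in $M$; an augmenting path is an alternating path joining two distinct unmatched vertices. Let $l_m$ be the length of a minimum length augmenting path ($l_m=\infty$ if there is none). For a vertex $v$, let $\mathrm{evenlevel}(v)$ (respectively $\mathrm{oddlevel}(v)$) be the length of a minimum even (respectively odd) length alternating path from an unmatched vertex to $v$, or $\infty$ if there is no such path; every path attaining this minimum is called an $\mathrm{evenlevel}(v)$ (respectively $\mathrm{oddlevel}(v)$) path. The tenacity of $v$ is $t(v)=\mathrm{evenlevel}(v)+\mathrm{oddlevel}(v)$. If $p$ is an $\mathrm{evenlevel}(v)$ or $\mathrm{oddlevel}(v)$ path starting at the unmatched vertex $f$ and $u$ lies on $p$, let $|p[f\text{ to }u]|$ be the length of the part of $p$ from $f$ to $u$; $u$ is BFS-honest with respect to $p$ if $|p[f\text{ to }u]|$ equals $\mathrm{evenlevel}(u)$ when it is even and $\mathrm{oddlevel}(u)$ when it is odd. For a vertex $v$ with $t(v)<l_m$ and an $\mathrm{evenlevel}(v)$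 or $\mathrm{oddlevel}(v)$ path $p$ starting at $f$, let $F(p,v)$ be the vertex of tenacity greater than $t(v)$ that is furthest from $f$ along $p$. If the set of all $F(p,v)$, over all $\mathrm{evenlevel}(v)$ and $\mathrm{oddlevel}(v)$ paths $p$, is a singleton $\{b\}$, then $b$ is called the base of $v$, written $\mathrm{base}(v)$. The iterated bases of $v$ are $\mathrm{base}^1(v)=\mathrm{base}(v)$, defined if $t(v)<l_m$, and, for $k\ge 1$, $\mathrm{base}^{k+1}(v)=\mathrm{base}(\mathrm{base}^k(v))$, defined if $\mathrm{base}^k(v)$ is defined and $t(\mathrm{base}^k(v))<l_m$. Then the base of every vertex of tenacity less than $l_m$ is well defined, and for every vertex $v$, each iterated base $b$ of $v$ lies on every $\mathrm{evenlevel}(v)$ path and on every $\mathrm{oddlevel}(v)$ path $p$, and $b$ is BFS-honest with respect to $p$. -/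

import Mathlib

namespace AltPath

section

variable {V : Type*} {G : SimpleGraph V}

/-- A vertex is unmatched (with respect to the matching `M`) if no edge of `M` covers it. -/
def Unmatched (M : G.Subgraph) (v : V) : Prop := v ∉ M.verts

/-- `p` is an alternating path: a simple path, any two consecutive edges of which consist of
one matched and one unmatched edge. -/
def IsAlternating (M : G.Subgraph) {u v : V} (p : G.Walk u v) : Prop :=
  p.IsPath ∧ p.edges.IsChain (fun e e' => e ∈ M.edgeSet ↔ e' ∉ M.edgeSet)

/-- An augmenting path: an alternating path joining two distinct unmatched vertices. -/
def IsAugmenting (M : G.Subgraph) {u v : V} (p : G.Walk u v) : Prop :=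
  IsAlternating M p ∧ Unmatched M u ∧ Unmatched M v ∧ u ≠ v

/-- `l_m`: the length of a minimum length augmenting path, `⊤` if there is none. -/
noncomputable def minAugLength (M : G.Subgraph) : ℕ∞ :=
  ⨅ (u : V) (v : V) (p : G.Walk u v) (_ : IsAugmenting M p), (p.length : ℕ∞)

/-- Minimum length of an even alternating path from an unmatched vertex to `v`
(`⊤` if there is none). -/
noncomputable def evenlevel (M : G.Subgraph) (v : V) : ℕ∞ :=
  ⨅ (f : V) (p : G.Walk f v) (_ : Unmatched M f ∧ IsAlternating M p ∧ Even p.length),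
    (p.length : ℕ∞)

/-- Minimum length of an odd alternating path from an unmatched vertex to `v`
(`⊤` if there is none). -/
noncomputable def oddlevel (M : G.Subgraph) (v : V) : ℕ∞ :=
  ⨅ (f : V) (p : G.Walk f v) (_ : Unmatched M f ∧ IsAlternating M p ∧ Odd p.length),
    (p.length : ℕ∞)

/-- `p` is an `evenlevel(v)` path. -/
def IsEvenlevelPath (M : G.Subgraph) {f v : V} (p : G.Walk f v) : Prop :=
  Unmatched M f ∧ IsAlternating M p ∧ Even p.length ∧ (p.length : ℕ∞) = evenlevel M v

/-- `p` is an `oddlevel(v)` path. -/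
def IsOddlevelPath (M : G.Subgraph) {f v : V} (p : G.Walk f v) : Prop :=
  Unmatched M f ∧ IsAlternating M p ∧ Odd p.length ∧ (p.length : ℕ∞) = oddlevel M v

/-- `p` is an `evenlevel(v)` path or an `oddlevel(v)` path. -/
def IsLevelPath (M : G.Subgraph) {f v : V} (p : G.Walk f v) : Prop :=
  IsEvenlevelPath M p ∨ IsOddlevelPath M p

/-- The tenacity of a vertex. -/
noncomputable def tenacity (M : G.Subgraph) (v : V) : ℕ∞ := evenlevel M v + oddlevel M v

variable [DecidableEq V]

/-- `u` is BFS-honest with respect to `p`: the part of `p` from its start `f` to `u` has length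
`evenlevel(u)` if that length is even and `oddlevel(u)` if it is odd. -/
def IsBFSHonest (M : G.Subgraph) {f v : V} (p : G.Walk f v) (u : V) (hu : u ∈ p.support) : Prop :=
  (Even (p.takeUntil u hu).length → ((p.takeUntil u hu).length : ℕ∞) = evenlevel M u) ∧
  (Odd (p.takeUntil u hu).length → ((p.takeUntil u hu).length : ℕ∞) = oddlevel M u)

/-- `b = F(p, v)`: among the vertices of `p` of tenacity greater than that of its end `v`, `b` is
the one furthest away from the start of `p` along `p`. -/
def IsBaseWrt (M : G.Subgraph) {f v : V} (p : G.Walk f v) (b : V) : Prop :=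
  ∃ hb : b ∈ p.support, tenacity M v < tenacity M b ∧
    ∀ (u : V) (hu : u ∈ p.support), tenacity M v < tenacity M u →
      (p.takeUntil u hu).length ≤ (p.takeUntil b hb).length

/-- The set of all `F(p, v)`, for `p` an `evenlevel(v)` or `oddlevel(v)` path. -/
def baseSet (M : G.Subgraph) (v : V) : Set V :=
  {b | ∃ (f : V) (p : G.Walk f v), IsLevelPath M p ∧ IsBaseWrt M p b}

/-- `b = base(v)`: `v` has tenacity less than `l_m` and `b` is the only element of `baseSet M v`. -/
def IsBase (M : G.Subgraph) (v b : V) : Prop :=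
  tenacity M v < minAugLength M ∧ baseSet M v = {b}

/-- `IsIteratedBase M v k b` says that `base^k(v)` is defined and equal to `b`, for `k ≥ 1`. -/
inductive IsIteratedBase (M : G.Subgraph) (v : V) : ℕ → V → Prop
  | one {b : V} : IsBase M v b → IsIteratedBase M v 1 b
  | succ {k : ℕ} {b c : V} :
      IsIteratedBase M v k b → IsBase M b c → IsIteratedBase M v (k + 1) c

end

end AltPath

/-!
The proof replaces the combinatorics of nested blossoms by linear programming duality.

For a threshold `τ < l_m` let `baseAt τ v` be the last vertex of tenacity greater than `τ` on a
level path of `v`. The fibres of `baseAt τ` play the role of the maximal blossoms of tenacity at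
most `τ`; they are nested as `τ` grows, and the base of `v` is `baseAt t(v) v`. By induction on `t`
two facts are proved together: `baseAt t` does not depend on the choice of the level path
(`UniqueBase`), and an unmatched edge `xy` with `evenlevel(x) + evenlevel(y) + 1 = t` lies within
one fibre of `baseAt t` (`EdgeClosed`).

Given these facts below `t` (`Stage`), the levels yield a feasible dual solution, namely the one the
primal-dual matching algorithm has at time `t / 2`: a vertex gets the variable `dualValue`, and
each threshold `τ < t` adds a constant to the variable of every fibre of `baseAt τ`. Summing the
constraints along an alternating path bounds its length from below (`Stage.balance_le`), the
contribution of the blossoms being controlled by a count of the matched minus the unmatched edges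
inside them (`AltSeq.excess_succ`). Level paths attain the bound, and being tight means that such a
path runs through each blossom in a single stretch and contains its base
(`Stage.tight`, `Stage.contiguous`, `Stage.exists_eq_baseAt`).

On the other hand vertices of tenacity at least `t(v)` are BFS-honest on level paths of `v`
(`IsLev.lev_eq`): splicing a shorter path into a level path either shortens it or bounds the
tenacity. If `P` and `Q` are level paths of opposite parity of a vertex of tenacity `t`, then
splicing shows that `Q` meets `P` not before the base vertex of `P`, tightness moves the meeting
point to a vertex of tenacity at least `t`, and honesty puts this vertex at the same position of
both paths. Either it is the base of `P`, or it has tenacity `t` and smaller levels, and induction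
applies (`Stage.eq_of_opposite`). The fact about edges follows in the same way.

The statement about iterated bases is a formal consequence: the base is honest, so the part of a
level path up to it is a level path again.
-/

namespace AltPath

variable {V : Type*} {G : SimpleGraph V} {M : G.Subgraph}

/-! ### Alternating paths as vertex sequences -/

/-- The first `n + 1` terms of `P` are the vertices of an alternating path of length `n` from an
unmatched vertex; the terms after `P n` are irrelevant. Since the start is unmatched, the parity of
the position of an edge decides whether it is in `M`. -/
structure AltSeq (M : G.Subgraph) (n : ℕ) (P : ℕ → V) : Prop where
  start : Unmatched M (P 0)
  inj : ∀ i j, i ≤ n → j ≤ n → P i = P j → i = j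
  adj : ∀ i, i < n → G.Adj (P i) (P (i + 1))
  alt : ∀ i, i < n → (M.Adj (P i) (P (i + 1)) ↔ Odd i)

lemma AltSeq.take {n : ℕ} {P : ℕ → V} (h : AltSeq M n P) {i : ℕ} (hi : i ≤ n) :
    AltSeq M i P where
  start := h.start
  inj a b ha hb := h.inj a b (ha.trans hi) (hb.trans hi)
  adj a ha := h.adj a (ha.trans_le hi)
  alt a ha := h.alt a (ha.trans_le hi)

/-- Extending an alternating path by one edge that fits the alternation. -/
lemma AltSeq.snoc {n : ℕ} {P : ℕ → V} (h : AltSeq M n P) {w : V} (hw : ∀ i ≤ n, P i ≠ w)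
    (hadj : G.Adj (P n) w) (halt : M.Adj (P n) w ↔ Odd n) :
    AltSeq M (n + 1) (fun k => if k ≤ n then P k else w) where
  start := by simpa using h.start
  inj a b ha hb hab := by
    grind [h.inj a b]
  adj a ha := by
    rcases Nat.lt_succ_iff_lt_or_eq.1 ha with h' | rfl
    · simpa [h'.le, Nat.succ_le_iff.2 h'] using h.adj a h'
    · simpa using hadj
  alt a ha := by
    rcases Nat.lt_succ_iff_lt_or_eq.1 ha with h' | rfl
    · simpa [h'.le, Nat.succ_le_iff.2 h'] using h.alt a h'
    · simpa using halt

lemma altSeq_getVert {f v : V} {p : G.Walk f v} (hf : Unmatched M f) (hp : IsAlternating M p) :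
    AltSeq M p.length p.getVert where
  start := by simpa using hf
  inj i j hi hj hij := hp.1.getVert_injOn hi hj hij
  adj i hi := p.adj_getVert_succ hi
  alt i hi := by
    have hc := List.isChain_iff_getElem.1 hp.2
    induction i with
    | zero =>
      simp only [SimpleGraph.Walk.getVert_zero, Nat.not_odd_zero, iff_false]
      exact fun h => hf h.fst_mem
    | succ k ih =>
      have h1 := ih (by omega)
      have h2 := hc k (by simpa using hi)
      simp only [SimpleGraph.Walk.getElem_edges, SimpleGraph.Subgraph.mem_edgeSet] at h2
      have h3 : Odd (k + 1) ↔ ¬ Odd k := Nat.odd_add_one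
      tauto

lemma AltSeq.exists_walk {n : ℕ} {P : ℕ → V} (h : AltSeq M n P) :
    ∃ p : G.Walk (P 0) (P n), p.length = n ∧ IsAlternating M p := by
  have key : ∀ m ≤ n, ∃ p : G.Walk (P 0) (P m), p.length = m ∧ ∀ i ≤ m, p.getVert i = P i := by
    intro m
    induction m with
    | zero => exact fun _ => ⟨.nil, rfl, by simp⟩
    | succ k ih =>
      intro hk
      obtain ⟨p, hp, hp'⟩ := ih (by omega)
      refine ⟨p.concat (h.adj k hk), by simp [hp], fun i hi => ?_⟩
      rw [SimpleGraph.Walk.concat_eq_append, SimpleGraph.Walk.getVert_append]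
      split_ifs with h1
      · exact hp' i (by omega)
      · obtain hik | hik : i = k ∨ i = k + 1 := by omega
        · simp [hp, hik]
        · simp [hp, hik]
  obtain ⟨p, hp, hp'⟩ := key n le_rfl
  refine ⟨p, hp, ?_, ?_⟩
  · rw [← SimpleGraph.Walk.IsPath.getVert_injOn_iff]
    intro i hi j hj hij
    rw [Set.mem_ofPred_eq, hp] at hi hj
    rw [hp' i hi, hp' j hj] at hij
    exact h.inj i j hi hj hij
  · rw [List.isChain_iff_getElem]
    intro i hi
    simp only [SimpleGraph.Walk.length_edges, hp] at hi
    simp only [SimpleGraph.Walk.getElem_edges, SimpleGraph.Subgraph.mem_edgeSet]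
    rw [hp' i (by omega), hp' (i + 1) (by omega), hp' (i + 1 + 1) (by omega),
      h.alt i (by omega), h.alt (i + 1) (by omega), Nat.odd_add_one, not_not]

/-! ### Levels -/

/-- The minimum length of an alternating path to `v` whose length has the parity of `n`. -/
noncomputable def lev (M : G.Subgraph) (n : ℕ) (v : V) : ℕ∞ :=
  if Even n then evenlevel M v else oddlevel M v

lemma lev_congr {m n : ℕ} (h : Even m ↔ Even n) (v : V) : lev M m v = lev M n v := by
  simp [lev, h]

lemma tenacity_eq_lev (n : ℕ) (v : V) : tenacity M v = lev M n v + lev M (n + 1) v := by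
  by_cases h : Even n
  · simp [lev, h, tenacity, Nat.even_add_one]
  · simp [lev, h, tenacity, Nat.even_add_one, add_comm]

lemma AltSeq.lev_le {n : ℕ} {P : ℕ → V} (h : AltSeq M n P) : lev M n (P n) ≤ n := by
  obtain ⟨p, hp, hp'⟩ := h.exists_walk
  unfold lev
  split_ifs with hn
  · refine (iInf_le_of_le (P 0) <| iInf_le_of_le p <|
      iInf_le_of_le ⟨h.start, hp', by rwa [hp]⟩ ?_)
    rw [hp]
  · refine (iInf_le_of_le (P 0) <| iInf_le_of_le p <|
      iInf_le_of_le ⟨h.start, hp', by rw [hp]; simpa using hn⟩ ?_)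
    rw [hp]

/-- The path `P` of length `n` realises the level of its end. -/
def IsLev (M : G.Subgraph) (n : ℕ) (P : ℕ → V) : Prop :=
  AltSeq M n P ∧ lev M n (P n) = n

/-- A finite infimum of lengths is attained. -/
lemma exists_walk_of_iInf_ne_top {v : V} {C : ∀ f : V, G.Walk f v → Prop}
    (h : (⨅ (f : V) (p : G.Walk f v) (_ : C f p), (p.length : ℕ∞)) ≠ ⊤) :
    ∃ (f : V) (p : G.Walk f v), C f p ∧
      (p.length : ℕ∞) = ⨅ (f : V) (p : G.Walk f v) (_ : C f p), (p.length : ℕ∞) := by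
  classical
  have hne : ∃ n : ℕ, ∃ (f : V) (p : G.Walk f v), C f p ∧ p.length = n := by
    by_contra hcon
    push Not at hcon
    apply h
    simp only [iInf_eq_top]
    exact fun f p hp => absurd rfl (hcon p.length f p hp)
  obtain ⟨f, p, hp, hlen⟩ := Nat.find_spec hne
  refine ⟨f, p, hp, le_antisymm ?_ (iInf_le_of_le f <| iInf_le_of_le p <| iInf_le_of_le hp le_rfl)⟩
  refine le_iInf fun f' => le_iInf fun p' => le_iInf fun hp' => ?_
  rw [hlen]
  exact_mod_cast Nat.find_min' hne ⟨f', p', hp', rfl⟩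

lemma exists_isLev {a : ℕ} {v : V} (h : lev M a v ≠ ⊤) :
    ∃ n P, IsLev M n P ∧ P n = v ∧ (Even n ↔ Even a) ∧ (n : ℕ∞) = lev M a v := by
  have h0 := h
  unfold lev at h
  split_ifs at h with ha
  · obtain ⟨f, p, ⟨hf, hp, he⟩, hlen⟩ := exists_walk_of_iInf_ne_top h
    have hl : (p.length : ℕ∞) = lev M a v := by rw [lev, if_pos ha]; exact hlen
    refine ⟨p.length, p.getVert, ⟨altSeq_getVert hf hp, ?_⟩, by simp, by simp [he, ha], hl⟩
    rw [p.getVert_length, lev_congr (n := a) (by simp [he, ha]), hl]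
  · obtain ⟨f, p, ⟨hf, hp, he⟩, hlen⟩ := exists_walk_of_iInf_ne_top h
    have hl : (p.length : ℕ∞) = lev M a v := by rw [lev, if_neg ha]; exact hlen
    have he' := Nat.not_even_iff_odd.2 he
    refine ⟨p.length, p.getVert, ⟨altSeq_getVert hf hp, ?_⟩, by simp, by simp [he', ha], hl⟩
    rw [p.getVert_length, lev_congr (n := a) (by simp [he', ha]), hl]

lemma isLevelPath_iff {f v : V} {p : G.Walk f v} :
    (IsEvenlevelPath M p ∨ IsOddlevelPath M p) ↔
      Unmatched M f ∧ IsAlternating M p ∧ IsLev M p.length p.getVert := by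
  constructor
  · rintro (⟨hf, hp, he, hl⟩ | ⟨hf, hp, he, hl⟩)
    · refine ⟨hf, hp, altSeq_getVert hf hp, ?_⟩
      rw [lev, if_pos he, p.getVert_length, hl]
    · refine ⟨hf, hp, altSeq_getVert hf hp, ?_⟩
      rw [lev, if_neg (Nat.not_even_iff_odd.2 he), p.getVert_length, hl]
  · rintro ⟨hf, hp, -, hl⟩
    rw [lev, p.getVert_length] at hl
    split_ifs at hl with he
    · exact Or.inl ⟨hf, hp, he, hl.symm⟩
    · exact Or.inr ⟨hf, hp, Nat.not_even_iff_odd.1 he, hl.symm⟩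

/-- An odd alternating path between unmatched vertices is augmenting, so unmatched vertices have
tenacity at least `l_m`. -/
lemma minAugLength_le_tenacity {f : V} (hf : Unmatched M f) : minAugLength M ≤ tenacity M f := by
  rw [tenacity_eq_lev 0]
  refine le_trans ?_ le_add_self
  by_cases h : lev M (0 + 1) f = ⊤
  · rw [h]; exact le_top
  · obtain ⟨n, P, hP, rfl, hn, hl⟩ := exists_isLev h
    rw [← hl]
    obtain ⟨p, hp, hp'⟩ := hP.1.exists_walk
    refine iInf_le_of_le _ <| iInf_le_of_le _ <| iInf_le_of_le p <|
      iInf_le_of_le ⟨hp', hP.1.start, hf, fun h0 => ?_⟩ (by rw [hp])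
    have := hP.1.inj 0 n (Nat.zero_le _) le_rfl h0
    subst this
    simp at hn

/-! ### Splicing alternating paths -/

/-- Following `Q` to the vertex `Q j = P i` and then `P` onwards, when the positions `i` and `j`
have the same parity. -/
lemma AltSeq.splice_forward {n m i j : ℕ} {P Q : ℕ → V} (hP : AltSeq M n P) (hQ : AltSeq M m Q)
    (hi : i ≤ n) (hj : j ≤ m) (hij : Q j = P i) (hpar : Even i ↔ Even j)
    (hd : ∀ a < j, ∀ b, i ≤ b → b ≤ n → Q a ≠ P b) :
    AltSeq M (j + (n - i)) (fun k => if k ≤ j then Q k else P (i + k - j)) where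
  start := by simpa using hQ.start
  inj a b ha hb hab := by
    have hQi := hQ.inj a b
    have hPi := hP.inj (i + a - j) (i + b - j)
    have h1 := fun h : a < j => hd a h (i + b - j)
    have h2 := fun h : b < j => hd b h (i + a - j)
    have h3 := hP.inj i (i + b - j)
    have h4 := hP.inj (i + a - j) i
    split_ifs at hab with h5 h6 h6
    · exact hQi (by omega) (by omega) hab
    · rcases h5.lt_or_eq with h | rfl
      · exact absurd hab (h1 h (by omega) (by omega))
      · have := h3 hi (by omega) (hij ▸ hab)
        omega
    · rcases h6.lt_or_eq with h | rfl
      · exact absurd hab.symm (h2 h (by omega) (by omega))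
      · have := h4 (by omega) hi (hij ▸ hab)
        omega
    · have := hPi (by omega) (by omega) hab
      omega
  adj k hk := by
    rcases lt_or_ge k j with h | h
    · simpa [h.le, Nat.succ_le_iff.2 h] using hQ.adj k (by omega)
    · have h1 : (if k ≤ j then Q k else P (i + k - j)) = P (i + k - j) := by
        split_ifs with h2
        · obtain rfl : k = j := by omega
          simpa using hij
        · rfl
      simp only [h1, if_neg (show ¬ k + 1 ≤ j by omega)]
      rw [show i + (k + 1) - j = i + k - j + 1 by omega]
      exact hP.adj _ (by omega)
  alt k hk := by
    rcases lt_or_ge k j with h | h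
    · simpa [h.le, Nat.succ_le_iff.2 h] using hQ.alt k (by omega)
    · have h1 : (if k ≤ j then Q k else P (i + k - j)) = P (i + k - j) := by
        split_ifs with h2
        · obtain rfl : k = j := by omega
          simpa using hij
        · rfl
      simp only [h1, if_neg (show ¬ k + 1 ≤ j by omega)]
      rw [show i + (k + 1) - j = i + k - j + 1 by omega, hP.alt _ (by omega)]
      simp only [Nat.even_iff, Nat.odd_iff] at hpar ⊢
      omega

/-- Following `Q` to the vertex `Q j = P i` and then `P` backwards to `P u`, when the positions
`i` and `j` have different parities. -/
lemma AltSeq.splice_backward {n m i j u : ℕ} {P Q : ℕ → V} (hP : AltSeq M n P)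
    (hQ : AltSeq M m Q) (hi : i ≤ n) (hj : j ≤ m) (hij : Q j = P i) (hpar : ¬(Even i ↔ Even j))
    (hu : u ≤ i) (hd : ∀ a < j, ∀ b, u ≤ b → b ≤ i → Q a ≠ P b) :
    AltSeq M (j + (i - u)) (fun k => if k ≤ j then Q k else P (i + j - k)) where
  start := by simpa using hQ.start
  inj a b ha hb hab := by
    have hQi := hQ.inj a b
    have hPi := hP.inj (i + j - a) (i + j - b)
    have h1 := fun h : a < j => hd a h (i + j - b)
    have h2 := fun h : b < j => hd b h (i + j - a)
    have h3 := hP.inj i (i + j - b)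
    have h4 := hP.inj (i + j - a) i
    split_ifs at hab with h5 h6 h6
    · exact hQi (by omega) (by omega) hab
    · rcases h5.lt_or_eq with h | rfl
      · exact absurd hab (h1 h (by omega) (by omega))
      · have := h3 hi (by omega) (hij ▸ hab)
        omega
    · rcases h6.lt_or_eq with h | rfl
      · exact absurd hab.symm (h2 h (by omega) (by omega))
      · have := h4 (by omega) hi (hij ▸ hab)
        omega
    · have := hPi (by omega) (by omega) hab
      omega
  adj k hk := by
    rcases lt_or_ge k j with h | h
    · simpa [h.le, Nat.succ_le_iff.2 h] using hQ.adj k (by omega)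
    · have h1 : (if k ≤ j then Q k else P (i + j - k)) = P (i + j - k) := by
        split_ifs with h2
        · obtain rfl : k = j := by omega
          simpa using hij
        · rfl
      simp only [h1, if_neg (show ¬ k + 1 ≤ j by omega)]
      rw [show i + j - k = i + j - (k + 1) + 1 by omega]
      exact (hP.adj _ (by omega)).symm
  alt k hk := by
    rcases lt_or_ge k j with h | h
    · simpa [h.le, Nat.succ_le_iff.2 h] using hQ.alt k (by omega)
    · have h1 : (if k ≤ j then Q k else P (i + j - k)) = P (i + j - k) := by
        split_ifs with h2
        · obtain rfl : k = j := by omega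
          simpa using hij
        · rfl
      simp only [h1, if_neg (show ¬ k + 1 ≤ j by omega)]
      rw [show i + j - k = i + j - (k + 1) + 1 by omega, M.adj_comm, hP.alt _ (by omega)]
      simp only [Nat.even_iff, Nat.odd_iff] at hpar ⊢
      omega

/-- If `Q` meets the part of `P` from position `u` on, then at the first such meeting point the
two paths can be spliced: forwards to the end of `P` if the parities of the two positions agree,
backwards to `P u` if they differ. -/
lemma AltSeq.exists_splice {n m u : ℕ} {P Q : ℕ → V} (hP : AltSeq M n P) (hQ : AltSeq M m Q)
    (hmeet : ∃ j ≤ m, ∃ i, u ≤ i ∧ i ≤ n ∧ Q j = P i) :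
    ∃ j ≤ m, ∃ i, u ≤ i ∧ i ≤ n ∧ Q j = P i ∧
      (((Even i ↔ Even j) ∧ lev M n (P n) ≤ (j + (n - i) : ℕ)) ∨
        (¬(Even i ↔ Even j) ∧ lev M (u + 1) (P u) ≤ (j + (i - u) : ℕ))) := by
  classical
  have hj := (Nat.find_spec hmeet).1
  obtain ⟨i, hui, hin, hij⟩ := (Nat.find_spec hmeet).2
  have hmin : ∀ a < Nat.find hmeet, ∀ b, u ≤ b → b ≤ n → Q a ≠ P b := fun a ha b hb hb' hab =>
    Nat.find_min hmeet ha ⟨by omega, b, hb, hb', hab⟩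
  generalize Nat.find hmeet = j at hj hij hmin
  refine ⟨j, hj, i, hui, hin, hij, ?_⟩
  by_cases hpar : Even i ↔ Even j
  · refine Or.inl ⟨hpar, ?_⟩
    have h := (hP.splice_forward hQ hin hj hij hpar
      fun a ha b hb hb' => hmin a ha b (by omega) hb').lev_le
    have hend : (if j + (n - i) ≤ j then Q (j + (n - i)) else P (i + (j + (n - i)) - j)) = P n := by
      split_ifs with h1
      · obtain rfl : i = n := by omega
        simpa using hij
      · congr 1; omega
    rw [hend] at h
    rwa [lev_congr (n := j + (n - i))]
    simp only [Nat.even_iff] at hpar ⊢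
    omega
  · refine Or.inr ⟨hpar, ?_⟩
    have h := (hP.splice_backward hQ hin hj hij hpar hui
      fun a ha b hb hb' => hmin a ha b hb (by omega)).lev_le
    have hend : (if j + (i - u) ≤ j then Q (j + (i - u)) else P (i + j - (j + (i - u)))) = P u := by
      split_ifs with h1
      · obtain rfl : i = u := by omega
        simpa using hij
      · congr 1; omega
    rw [hend] at h
    rwa [lev_congr (n := j + (i - u))]
    simp only [Nat.even_iff] at hpar ⊢
    omega

lemma IsLev.take {n u : ℕ} {P : ℕ → V} (hP : IsLev M n P) (hu : u ≤ n)
    (h : lev M u (P u) = u) : IsLev M u P :=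
  ⟨hP.1.take hu, h⟩

/-- A vertex of a level path that is reached later than necessary has small tenacity: a shorter
path to it would otherwise shorten the level path. -/
lemma IsLev.tenacity_lt_of_lev_ne {n u : ℕ} {P : ℕ → V} (hP : IsLev M n P) (hu : u ≤ n)
    (h : lev M u (P u) ≠ u) :
    ∃ m < u, lev M u (P u) = m ∧ tenacity M (P u) < (n + u : ℕ) := by
  have hle := (hP.1.take hu).lev_le
  have hlt : lev M u (P u) < u := lt_of_le_of_ne hle h
  obtain ⟨m, Q, hQ, hQm, hpar, hm⟩ := exists_isLev (ne_top_of_lt hlt)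
  have hmu : m < u := by rw [← hm] at hlt; exact_mod_cast hlt
  refine ⟨m, hmu, hm.symm, ?_⟩
  obtain ⟨j, hj, i, hui, hin, hij, ⟨h1, h2⟩ | ⟨h1, h2⟩⟩ :=
    hP.1.exists_splice hQ.1 (u := u) ⟨m, le_rfl, u, le_rfl, hu, hQm⟩
  · rw [hP.2] at h2
    have : n ≤ j + (n - i) := by exact_mod_cast h2
    omega
  · rw [tenacity_eq_lev u, ← hm]
    calc (m : ℕ∞) + lev M (u + 1) (P u) ≤ m + (j + (i - u) : ℕ) := by gcongr
      _ < (n + u : ℕ) := by norm_cast; omega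

/-- On a level path of `v`, the vertices of tenacity at least `t(v)` are BFS-honest. -/
lemma IsLev.lev_eq {n u : ℕ} {P : ℕ → V} (hP : IsLev M n P) (hu : u ≤ n)
    (hfin : tenacity M (P n) ≠ ⊤) (ht : tenacity M (P n) ≤ tenacity M (P u)) :
    lev M u (P u) = u := by
  by_contra h
  obtain ⟨m, hmu, hm, hlt⟩ := hP.tenacity_lt_of_lev_ne hu h
  rw [tenacity_eq_lev n, hP.2] at ht hfin
  have hfin' : lev M (n + 1) (P n) ≠ ⊤ := fun h => hfin (by rw [h]; exact add_top _)
  obtain ⟨n', Q, hQ, hQn, hpar, hn'⟩ := exists_isLev hfin'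
  rw [← hn'] at ht
  have hsum : n + n' < n + u := by exact_mod_cast ht.trans_lt hlt
  obtain ⟨j, hj, i, hui, hin, hij, ⟨h1, h2⟩ | ⟨h1, h2⟩⟩ :=
    hP.1.exists_splice hQ.1 (u := u) ⟨n', le_rfl, n, hu, le_rfl, hQn⟩
  · rw [hP.2] at h2
    have : n ≤ j + (n - i) := by exact_mod_cast h2
    omega
  · rw [tenacity_eq_lev u, hm] at ht
    have : (n + n' : ℕ∞) ≤ m + (j + (i - u) : ℕ) := ht.trans (by gcongr)
    have : n + n' ≤ m + (j + (i - u)) := by exact_mod_cast this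
    omega

/-- If `Q` meets `P` from position `u` on and the total length is less than the tenacity of the
honest vertex `P u`, then the paths meet there at positions of equal parity: otherwise splicing
backwards to `P u` would bound its tenacity by the total length. -/
lemma IsLev.exists_common {n m u : ℕ} {P Q : ℕ → V} (hP : IsLev M n P) (hQ : AltSeq M m Q)
    (hlev : lev M u (P u) = u) (hlt : (n + m : ℕ) < tenacity M (P u))
    (hmeet : ∃ j ≤ m, ∃ i, u ≤ i ∧ i ≤ n ∧ Q j = P i) :
    ∃ j ≤ m, ∃ i, u ≤ i ∧ i ≤ n ∧ Q j = P i ∧ (Even i ↔ Even j) := by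
  obtain ⟨j, hj, i, hui, hin, hij, ⟨h1, h2⟩ | ⟨h1, h2⟩⟩ := hP.1.exists_splice hQ hmeet
  · exact ⟨j, hj, i, hui, hin, hij, h1⟩
  · rw [tenacity_eq_lev u, hlev] at hlt
    have : ((n + m : ℕ) : ℕ∞) < u + (j + (i - u) : ℕ) := hlt.trans_le (by gcongr)
    have : n + m < u + (j + (i - u)) := by exact_mod_cast this
    omega

/-! ### Bases relative to a tenacity threshold -/

open Classical in
/-- The last position `i ≤ n` of `P` at which the tenacity exceeds `τ`. -/
noncomputable def lastPos (M : G.Subgraph) (τ n : ℕ) (P : ℕ → V) : ℕ :=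
  Nat.findGreatest (fun i => (τ : ℕ∞) < tenacity M (P i)) n

lemma lastPos_le (τ n : ℕ) (P : ℕ → V) : lastPos M τ n P ≤ n := by
  classical exact Nat.findGreatest_le n

lemma tenacity_le_of_lastPos_lt {τ n i : ℕ} {P : ℕ → V} (h : lastPos M τ n P < i) (hi : i ≤ n) :
    tenacity M (P i) ≤ τ := by
  classical exact not_lt.1 (Nat.findGreatest_is_greatest h hi)

lemma le_lastPos {τ n i : ℕ} {P : ℕ → V} (hi : i ≤ n) (h : (τ : ℕ∞) < tenacity M (P i)) :
    i ≤ lastPos M τ n P := by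
  classical exact Nat.le_findGreatest (P := fun i => (τ : ℕ∞) < tenacity M (P i)) hi h

lemma AltSeq.lt_tenacity_lastPos {τ n : ℕ} {P : ℕ → V} (hP : AltSeq M n P)
    (hfree : ∀ f, Unmatched M f → (τ : ℕ∞) < tenacity M f) :
    (τ : ℕ∞) < tenacity M (P (lastPos M τ n P)) := by
  classical
  exact Nat.findGreatest_spec (P := fun i => (τ : ℕ∞) < tenacity M (P i)) (Nat.zero_le n)
    (hfree _ hP.start)

lemma lastPos_eq {τ n i : ℕ} {P : ℕ → V} (hi : i ≤ n) (h : (τ : ℕ∞) < tenacity M (P i))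
    (hgt : ∀ k, i < k → k ≤ n → tenacity M (P k) ≤ τ) : lastPos M τ n P = i := by
  refine le_antisymm ?_ (le_lastPos hi h)
  by_contra hcon
  push Not at hcon
  classical
  have h1 : (τ : ℕ∞) < tenacity M (P (lastPos M τ n P)) :=
    Nat.findGreatest_spec (P := fun i => (τ : ℕ∞) < tenacity M (P i)) hi h
  exact absurd (hgt _ hcon (lastPos_le _ _ _)) (not_le.2 h1)

lemma lastPos_self {τ n : ℕ} {P : ℕ → V} (h : (τ : ℕ∞) < tenacity M (P n)) :
    lastPos M τ n P = n :=
  lastPos_eq le_rfl h fun _ h1 h2 => absurd h1 h2.not_gt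

lemma AltSeq.lastPos_take {τ n i : ℕ} {P : ℕ → V} (hP : AltSeq M n P)
    (hfree : ∀ f, Unmatched M f → (τ : ℕ∞) < tenacity M f) (hi : i ≤ n)
    (h : lastPos M τ n P ≤ i) : lastPos M τ i P = lastPos M τ n P :=
  lastPos_eq h (hP.lt_tenacity_lastPos hfree)
    fun _ h1 h2 => tenacity_le_of_lastPos_lt h1 (h2.trans hi)

/-- All level paths of a vertex have the same last vertex of tenacity exceeding `τ`. -/
def UniqueBase (M : G.Subgraph) (τ : ℕ) : Prop :=
  ∀ n P n' P', IsLev M n P → IsLev M n' P' → P n = P' n' →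
    P (lastPos M τ n P) = P' (lastPos M τ n' P')

open Classical in
/-- The last vertex of tenacity exceeding `τ` on a chosen level path of `v`; it is `v` itself if
`v` has no level path. The fibres of this map play the role of the blossoms of tenacity at most
`τ`, each of them containing its base as its only vertex of tenacity exceeding `τ`. -/
noncomputable def baseAt (M : G.Subgraph) (τ : ℕ) (v : V) : V :=
  if h : ∃ n P, IsLev M n P ∧ P n = v then
    h.choose_spec.choose (lastPos M τ h.choose h.choose_spec.choose)
  else v

lemma UniqueBase.baseAt_eq {τ n : ℕ} {P : ℕ → V} (hU : UniqueBase M τ) (hP : IsLev M n P) :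
    baseAt M τ (P n) = P (lastPos M τ n P) := by
  have h : ∃ m Q, IsLev M m Q ∧ Q m = P n := ⟨n, P, hP, rfl⟩
  rw [baseAt, dif_pos h]
  exact hU _ _ _ _ h.choose_spec.choose_spec.1 hP h.choose_spec.choose_spec.2

lemma baseAt_of_lt {τ : ℕ} {v : V} (h : (τ : ℕ∞) < tenacity M v) : baseAt M τ v = v := by
  unfold baseAt
  split_ifs with h1
  · have h2 := h1.choose_spec.choose_spec.2
    rw [lastPos_self (by rwa [h2]), h2]
  · rfl

lemma exists_isLev_of_tenacity_ne_top {v : V} (a : ℕ) (h : tenacity M v ≠ ⊤) :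
    ∃ n P, IsLev M n P ∧ P n = v ∧ (Even n ↔ Even a) ∧ (n : ℕ∞) = lev M a v :=
  exists_isLev fun h' => h (by rw [tenacity_eq_lev a, h']; exact top_add _)

lemma lt_tenacity_baseAt {τ : ℕ} (hfree : ∀ f, Unmatched M f → (τ : ℕ∞) < tenacity M f) (v : V) :
    (τ : ℕ∞) < tenacity M (baseAt M τ v) := by
  unfold baseAt
  split_ifs with h1
  · exact h1.choose_spec.choose_spec.1.1.lt_tenacity_lastPos hfree
  · by_contra hcon
    have hne : tenacity M v ≠ ⊤ := ne_top_of_le_ne_top (ENat.natCast_ne_top τ) (not_lt.1 hcon)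
    obtain ⟨n, P, hP, hPn, -⟩ := exists_isLev_of_tenacity_ne_top 0 hne
    exact h1 ⟨n, P, hP, hPn⟩

lemma baseAt_idem {τ : ℕ} (hfree : ∀ f, Unmatched M f → (τ : ℕ∞) < tenacity M f) (v : V) :
    baseAt M τ (baseAt M τ v) = baseAt M τ v :=
  baseAt_of_lt (lt_tenacity_baseAt hfree v)

lemma baseAt_eq_self_iff {τ : ℕ} (hfree : ∀ f, Unmatched M f → (τ : ℕ∞) < tenacity M f) {v : V} :
    baseAt M τ v = v ↔ (τ : ℕ∞) < tenacity M v :=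
  ⟨fun h => h ▸ lt_tenacity_baseAt hfree v, baseAt_of_lt⟩

/-- The initial part of a level path up to a vertex beyond the threshold is a level path. -/
lemma IsLev.take_lastPos {τ n : ℕ} {P : ℕ → V} (hP : IsLev M n P)
    (hfree : ∀ f, Unmatched M f → (τ : ℕ∞) < tenacity M f) (ht : tenacity M (P n) ≤ τ) :
    IsLev M (lastPos M τ n P) P :=
  hP.take (lastPos_le _ _ _) (hP.lev_eq (lastPos_le _ _ _)
    (ne_top_of_le_ne_top (ENat.natCast_ne_top τ) ht) (ht.trans (hP.1.lt_tenacity_lastPos hfree).le))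

lemma lastPos_anti {σ τ : ℕ} (h : σ ≤ τ) {n : ℕ} {P : ℕ → V} (hP : AltSeq M n P)
    (hfree : ∀ f, Unmatched M f → (τ : ℕ∞) < tenacity M f) :
    lastPos M τ n P ≤ lastPos M σ n P :=
  le_lastPos (lastPos_le _ _ _)
    (lt_of_le_of_lt (by exact_mod_cast h) (hP.lt_tenacity_lastPos hfree))

/-- The families of blossoms for different thresholds are nested. -/
lemma baseAt_baseAt {σ τ : ℕ} (h : σ ≤ τ) (hσ : UniqueBase M σ) (hτ : UniqueBase M τ)
    (hfree : ∀ f, Unmatched M f → (τ : ℕ∞) < tenacity M f) (v : V) :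
    baseAt M τ (baseAt M σ v) = baseAt M τ v := by
  rcases lt_or_ge (σ : ℕ∞) (tenacity M v) with hv | hv
  · rw [baseAt_of_lt hv]
  · have hne : tenacity M v ≠ ⊤ := ne_top_of_le_ne_top (ENat.natCast_ne_top σ) hv
    have hfree' : ∀ f, Unmatched M f → (σ : ℕ∞) < tenacity M f := fun f hf =>
      lt_of_le_of_lt (by exact_mod_cast h) (hfree f hf)
    obtain ⟨n, P, hP, rfl, -⟩ := exists_isLev_of_tenacity_ne_top 0 hne
    rw [hσ.baseAt_eq hP, hτ.baseAt_eq (hP.take_lastPos hfree' hv), hτ.baseAt_eq hP,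
      hP.1.lastPos_take hfree (lastPos_le _ _ _) (lastPos_anti h hP.1 hfree)]

/-! ### Matched edges -/

lemma mate_unique (hM : M.IsMatching) {x y z : V} (hy : M.Adj x y) (hz : M.Adj x z) : y = z :=
  (hM hy.fst_mem).unique hy hz

/-- An odd alternating path can be extended by the matched edge at its end. -/
lemma AltSeq.snoc_mate (hM : M.IsMatching) {n : ℕ} {P : ℕ → V} (hP : AltSeq M n P) (hn : Odd n)
    {x : V} (hx : M.Adj (P n) x) :
    AltSeq M (n + 1) (fun k => if k ≤ n then P k else x) := by
  refine hP.snoc (fun i hi hPx => ?_) hx.adj_sub (by simp [hx, hn])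
  subst hPx
  have hin : i < n := lt_of_le_of_ne hi fun h => M.loopless.irrefl _ (h ▸ hx)
  by_cases hodd : Odd i
  · have h1 := hP.inj n (i + 1) le_rfl hin (mate_unique hM hx.symm ((hP.alt i hin).2 hodd))
    subst h1
    exact (Nat.odd_add_one.1 hn) hodd
  · obtain _ | k := i
    · exact hP.start hx.snd_mem
    · have hk : Odd k := by
        rw [Nat.odd_add_one, not_not] at hodd; exact hodd
      have h1 := hP.inj n k le_rfl (by omega)
        (mate_unique hM hx.symm ((hP.alt k (by omega)).2 hk).symm)
      omega

/-- An even alternating path ends with a matched edge, so the levels of mates determine each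
other. -/
lemma lev_mate (hM : M.IsMatching) {x y : V} (h : M.Adj x y) :
    lev M 0 x = lev M 1 y + 1 := by
  apply le_antisymm
  · by_cases hy : lev M 1 y = ⊤
    · simp [hy]
    · obtain ⟨n, P, hP, rfl, hn, hl⟩ := exists_isLev hy
      have hn : Odd n := by simpa using hn
      have h1 := (hP.1.snoc_mate hM hn h.symm).lev_le
      simp only [if_neg (show ¬ n + 1 ≤ n by omega)] at h1
      rw [lev_congr (n := n + 1) (by simp [hn]), ← hl]
      exact_mod_cast h1
  · by_cases hx : lev M 0 x = ⊤
    · rw [hx]; exact le_top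
    · obtain ⟨n, P, hP, rfl, hn, hl⟩ := exists_isLev hx
      have hn : Even n := by simpa using hn
      obtain _ | k := n
      · exact absurd h.fst_mem hP.1.start
      · have hk : Odd k := by
          rw [Nat.even_add_one, Nat.not_even_iff_odd] at hn; exact hn
        have h1 : P k = y := mate_unique hM ((hP.1.alt k (by omega)).2 hk).symm h
        have h2 := (hP.1.take (Nat.le_succ k)).lev_le
        rw [lev_congr (n := 1) (by simp [hk]), h1] at h2
        rw [← hl]
        push_cast
        gcongr

lemma tenacity_mate (hM : M.IsMatching) {x y : V} (h : M.Adj x y) :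
    tenacity M x = tenacity M y := by
  rw [tenacity_eq_lev 0 x, tenacity_eq_lev 0 y, lev_mate hM h, lev_mate hM h.symm]
  ring

/-- Matched edges stay inside blossoms, except at the base. -/
lemma baseAt_mate (hM : M.IsMatching) {τ : ℕ} (hU : UniqueBase M τ)
    {x y : V} (h : M.Adj x y) (hx : tenacity M x ≤ τ)
    (hfree : ∀ f, Unmatched M f → (τ : ℕ∞) < tenacity M f) :
    baseAt M τ x = baseAt M τ y := by
  have hne : tenacity M y ≠ ⊤ := by
    rw [← tenacity_mate hM h]; exact ne_top_of_le_ne_top (ENat.natCast_ne_top τ) hx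
  obtain ⟨n, P, hP, rfl, hn, hl⟩ := exists_isLev_of_tenacity_ne_top 1 hne
  have hn : Odd n := by simpa using hn
  have hR := hP.1.snoc_mate hM hn h.symm
  set R : ℕ → V := fun k => if k ≤ n then P k else x with hRdef
  have hRn : R (n + 1) = x := by simp [hRdef]
  have hRk : ∀ k ≤ n, R k = P k := fun k hk => by simp [hRdef, hk]
  have hlev : IsLev M (n + 1) R := by
    refine ⟨hR, ?_⟩
    rw [hRn, lev_congr (n := 0) (by simp [hn]), lev_mate hM h, ← hl]
    rfl
  have hle := lastPos_le (M := M) τ n P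
  have hlast : lastPos M τ (n + 1) R = lastPos M τ n P := by
    refine lastPos_eq (by omega) ?_ fun k hk hk' => ?_
    · rw [hRk _ hle]; exact hP.1.lt_tenacity_lastPos hfree
    · rcases Nat.lt_or_ge n k with h1 | h1
      · rw [show k = n + 1 by omega, hRn]; exact hx
      · rw [hRk k h1]; exact tenacity_le_of_lastPos_lt hk h1
  rw [hU.baseAt_eq hP, ← hRn, hU.baseAt_eq hlev, hlast, hRk _ hle]

/-! ### How an alternating path traverses a partition into classes -/

section Traversal

variable [DecidableEq V] {β : V → V} {n : ℕ} {P : ℕ → V}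

/-- The number of matched edges minus the number of unmatched edges, among the first `i` edges of
`P`, that lie within a fibre of `β`. -/
def balance (β : V → V) (P : ℕ → V) (i : ℕ) : ℤ :=
  ∑ k ∈ Finset.range i, if β (P k) = β (P (k + 1)) then (if Odd k then 1 else -1) else 0

/-- The bases of the fibres of `β` visited by `P` up to position `i` which themselves are not
visited. -/
def missedBases (β : V → V) (P : ℕ → V) (i : ℕ) : Finset V :=
  ((Finset.range (i + 1)).image P).image β \ (Finset.range (i + 1)).image P

/-- The amount by which the balance exceeds its least possible value. That value is the number of
missed bases, lowered by one while the path is inside a fibre and has arrived at its last vertex,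
not the base, by an unmatched edge. -/
def excess (β : V → V) (P : ℕ → V) (i : ℕ) : ℤ :=
  balance β P i - (missedBases β P i).card + if Odd i ∧ β (P i) ≠ P i then 1 else 0

omit [DecidableEq V] in
lemma mate_fixed (hmate : ∀ x y, M.Adj x y → β x ≠ x → β y = β x ∧ β y ≠ y)
    {x y : V} (h : M.Adj x y) (hx : β x = x) : β y = y := by
  by_contra hy
  exact (hmate y x h.symm hy).2 hx

/-- The excess never decreases, and it increases whenever the path enters a fibre of `β` that it
has visited before. -/
lemma AltSeq.excess_succ (hP : AltSeq M n P)
    (hmate : ∀ x y, M.Adj x y → β x ≠ x → β y = β x ∧ β y ≠ y) {i : ℕ} (hi : i < n) :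
    excess β P i ≤ excess β P (i + 1) ∧
      (β (P (i + 1)) ≠ β (P i) → (∃ k ≤ i, β (P k) = β (P (i + 1))) →
        excess β P i + 1 ≤ excess β P (i + 1)) := by
  set S := (Finset.range (i + 1)).image P with hS
  set w := P (i + 1) with hw
  have hS' : (Finset.range (i + 1 + 1)).image P = insert w S := by
    rw [Finset.range_add_one, Finset.image_insert]
  have hwS : w ∉ S := by
    simp only [hS, Finset.mem_image, Finset.mem_range, not_exists, not_and]
    intro k hk h
    have := hP.inj k (i + 1) (by omega) (by omega) h
    omega
  have hvisit : (∃ k ≤ i, β (P k) = β w) ↔ β w ∈ S.image β := by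
    simp [hS]
  have hm : missedBases β P i = S.image β \ S := rfl
  have hm' : missedBases β P (i + 1) = insert (β w) (S.image β) \ insert w S := by
    rw [missedBases, hS', Finset.image_insert]
  have hbal : balance β P (i + 1) = balance β P i +
      if β (P i) = β w then (if Odd i then 1 else -1) else 0 := by
    rw [balance, Finset.sum_range_succ]; rfl
  have hPi : β (P i) ∈ S.image β := by
    refine Finset.mem_image_of_mem _ (Finset.mem_image_of_mem _ (by simp))
  -- the effect of the new vertex on the number of missed bases
  have c1 : β w ∈ S.image β → (missedBases β P (i + 1)).card ≤ (missedBases β P i).card := by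
    intro h2
    rw [hm, hm', Finset.insert_eq_of_mem h2]
    exact Finset.card_le_card (Finset.sdiff_subset_sdiff subset_rfl (Finset.subset_insert _ _))
  have c2 : (missedBases β P (i + 1)).card ≤ (missedBases β P i).card + 1 := by
    rw [hm, hm']
    refine (Finset.card_le_card (t := insert (β w) (S.image β \ S)) fun x hx => ?_).trans
      (Finset.card_insert_le _ _)
    rw [Finset.mem_sdiff, Finset.mem_insert, Finset.mem_insert, not_or] at hx
    rw [Finset.mem_insert, Finset.mem_sdiff]
    exact hx.1.imp_right fun h => ⟨h, hx.2.2⟩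
  have c3 : β w = w → β w ∈ S.image β →
      (missedBases β P (i + 1)).card + 1 = (missedBases β P i).card := by
    intro h1 h2
    rw [hm, hm', Finset.insert_eq_of_mem h2, Finset.sdiff_insert]
    refine Finset.card_erase_add_one (Finset.mem_sdiff.2 ⟨?_, hwS⟩)
    rwa [h1] at h2
  have c4 : β w = w → (missedBases β P (i + 1)).card ≤ (missedBases β P i).card := by
    intro h1
    rw [hm, hm', h1]
    refine Finset.card_le_card fun x hx => ?_
    rw [Finset.mem_sdiff, Finset.mem_insert, Finset.mem_insert, not_or] at hx
    exact Finset.mem_sdiff.2 ⟨hx.1.resolve_left hx.2.1, hx.2.2⟩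
  have hne : P i ≠ w := fun h => by
    have := hP.inj i (i + 1) (by omega) (by omega) h
    omega
  unfold excess
  rw [hvisit, hbal, ← hw]
  by_cases hodd : Odd i
  · have hadj : M.Adj (P i) w := (hP.alt i hi).2 hodd
    have hodd' : ¬ Odd (i + 1) := by rw [Nat.odd_add_one, not_not]; exact hodd
    by_cases hfix : β (P i) = P i
    · have hwfix := mate_fixed hmate hadj hfix
      have h1 : β (P i) ≠ β w := by rw [hfix, hwfix]; exact hne
      simp only [hodd, hodd', hfix, hwfix, ne_eq, not_true, and_false, if_false]
      rw [if_neg hne]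
      refine ⟨?_, fun _ h3 => ?_⟩
      · have := c4 hwfix; omega
      · have := c3 hwfix (by rwa [hwfix]); omega
    · obtain ⟨h1, h2⟩ := hmate _ _ hadj hfix
      have := c1 (h1 ▸ hPi)
      simp only [hodd, hodd', hfix, h1, ne_eq, not_true, not_false_iff, and_self, false_and,
        if_true, if_false, false_imp_iff, and_true]
      omega
  · have hodd' : Odd (i + 1) := Nat.odd_add_one.2 hodd
    by_cases hcl : β (P i) = β w
    · have hv : β w ∈ S.image β := hcl ▸ hPi
      by_cases hwfix : β w = w
      · have := c3 hwfix hv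
        simp only [hodd, hodd', hcl, hwfix, ne_eq, not_true, and_false, false_and,
          if_true, if_false, false_imp_iff, and_true]
        omega
      · have := c1 hv
        simp only [hodd, hodd', hcl, hwfix, ne_eq, not_true, not_false_iff, and_self, false_and,
          if_true, if_false, false_imp_iff, and_true]
        omega
    · by_cases hwfix : β w = w
      · rw [hwfix] at hcl
        simp only [hodd, hodd', hcl, hwfix, ne_eq, not_true, and_false, false_and, if_false]
        refine ⟨?_, fun _ h3 => ?_⟩
        · have := c4 hwfix
          omega
        · have := c3 hwfix (by rwa [hwfix])
          omega
      · simp only [hodd, hodd', hcl, hwfix, ne_eq, not_false_iff, and_self, false_and,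
          if_true, if_false]
        refine ⟨?_, fun _ h3 => ?_⟩
        · omega
        · have := c1 h3; omega

lemma AltSeq.excess_mono (hP : AltSeq M n P)
    (hmate : ∀ x y, M.Adj x y → β x ≠ x → β y = β x ∧ β y ≠ y) {i j : ℕ} (hij : i ≤ j)
    (hj : j ≤ n) : excess β P i ≤ excess β P j := by
  induction j, hij using Nat.le_induction with
  | base => exact le_rfl
  | succ k hk ih => exact (ih (by omega)).trans (hP.excess_succ hmate hj).1

lemma excess_zero (h0 : β (P 0) = P 0) : excess β P 0 = 0 := by
  simp [excess, balance, missedBases, h0]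

lemma AltSeq.excess_nonneg (hP : AltSeq M n P)
    (hmate : ∀ x y, M.Adj x y → β x ≠ x → β y = β x ∧ β y ≠ y) (h0 : β (P 0) = P 0) :
    0 ≤ excess β P n := by
  rw [← excess_zero (β := β) h0]
  exact hP.excess_mono hmate (Nat.zero_le n) le_rfl

/-- A path without excess visits each fibre of `β` in one stretch. -/
lemma AltSeq.contiguous (hP : AltSeq M n P)
    (hmate : ∀ x y, M.Adj x y → β x ≠ x → β y = β x ∧ β y ≠ y) (h0 : β (P 0) = P 0)
    (hex : excess β P n = 0) {i j k : ℕ} (hij : i ≤ j) (hjk : j ≤ k) (hk : k ≤ n)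
    (h : β (P i) = β (P k)) : β (P j) = β (P k) := by
  have hstep : ∀ m < n, β (P (m + 1)) ≠ β (P m) → ∀ l ≤ m, β (P l) ≠ β (P (m + 1)) := by
    intro m hm h1 l hl h2
    have h3 := (hP.excess_succ hmate hm).2 h1 ⟨l, hl, h2⟩
    have h4 := hP.excess_mono hmate (Nat.zero_le m) hm.le
    have h5 := hP.excess_mono hmate (show m + 1 ≤ n from hm) le_rfl
    rw [excess_zero h0] at h4
    omega
  induction k, hjk using Nat.le_induction with
  | base => rfl
  | succ m hm ih =>
    by_cases h1 : β (P (m + 1)) = β (P m)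
    · rw [h1] at h ⊢
      exact ih (by omega) h
    · exact absurd h (hstep m (by omega) h1 i (by omega))

/-- A path that misses no base contains the base of each of its vertices. -/
lemma exists_eq_of_missedBases_eq_empty (hmiss : missedBases β P n = ∅) {i : ℕ} (hi : i ≤ n) :
    ∃ j ≤ n, P j = β (P i) := by
  have h1 : β (P i) ∈ ((Finset.range (n + 1)).image P).image β :=
    Finset.mem_image_of_mem _ (Finset.mem_image_of_mem _ (by simpa [Nat.lt_succ_iff] using hi))
  have h2 := Finset.sdiff_eq_empty_iff_subset.1 hmiss h1
  simpa [Nat.lt_succ_iff] using h2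

end Traversal

/-! ### The dual potential -/

/-- Twice the dual variable, at time `t / 2` of the primal-dual matching algorithm, of a vertex
with evenlevel `a` and oddlevel `b`. The first case covers the vertices that are outer or already
in a blossom at that time, the second the inner ones, the third those not yet reached. Doubling
avoids half-integers. -/
noncomputable def dualValue (t : ℕ) (a b : ℕ∞) : ℤ :=
  open Classical in
  if a + b ≤ t ∨ 2 * a < t then t - 2 * a.toNat
  else if 2 * b < t then 2 * b.toNat - t
  else 0

lemma dualValue_add_le {t K : ℕ} {a b a' b' : ℕ∞}
    (h : a ≠ ⊤ → b' ≤ a + 1 ∨ a' < a) (h' : a' ≠ ⊤ → b ≤ a' + 1 ∨ a < a')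
    (hK : ∀ θ : ℕ, a + a' + 1 = θ → θ < t → t ≤ θ + K) :
    dualValue t a b + dualValue t a' b' ≤ 2 + 2 * K := by
  unfold dualValue
  cases a using ENat.recTopCoe <;> cases b using ENat.recTopCoe <;>
  cases a' using ENat.recTopCoe <;> cases b' using ENat.recTopCoe <;>
  norm_cast at h h' hK ⊢ <;>
  simp only [top_add, add_top, top_le_iff, ENat.natCast_ne_top, ENat.toNat_natCast,
    ENat.toNat_top, Int.subNatNat_eq_coe, ENat.mul_top,
    not_top_lt, ne_eq, forall_eq', OfNat.ofNat_ne_zero, not_false_eq_true, forall_true_left,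
    not_true, le_top, true_or, or_false, false_or, ENat.natCast_lt_top, ENat.top_ne_natCast]
    at h h' hK ⊢ <;>
  split_ifs <;> first | contradiction | omega

lemma le_dualValue_add {t K : ℕ} {a b a' b' : ℕ∞} (h : a = b' + 1) (h' : a' = b + 1)
    (hK : ∀ s : ℕ, a + b = s → K ≤ t - s) (hK' : t < a + b → K = 0) :
    2 * K ≤ 2 + (dualValue t a b + dualValue t a' b') := by
  subst h h'
  unfold dualValue
  cases b using ENat.recTopCoe <;> cases b' using ENat.recTopCoe <;>
  norm_cast at hK hK' ⊢ <;>
  simp only [top_add, add_top, top_le_iff, ENat.natCast_ne_top, ENat.toNat_natCast,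
    ENat.toNat_top, Int.subNatNat_eq_coe, ENat.mul_top,
    not_top_lt, ne_eq, forall_eq', OfNat.ofNat_ne_zero, not_false_eq_true, forall_true_left,
    or_false, false_or, ENat.natCast_lt_top] at hK hK' ⊢ <;>
  split_ifs <;> first | contradiction | omega

/-- An unmatched edge `xy` with `evenlevel(x) + evenlevel(y) + 1 = θ`, the tenacity of the edge,
lies within a blossom of tenacity at most `θ`. -/
def EdgeClosed (M : G.Subgraph) (θ : ℕ) : Prop :=
  ∀ x y, G.Adj x y → ¬ M.Adj x y → lev M 0 x + lev M 0 y + 1 = θ → baseAt M θ x = baseAt M θ y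

/-- The facts about tenacities below `t` from which those about tenacity `t` are derived. -/
structure Stage (M : G.Subgraph) (t : ℕ) : Prop where
  free : ∀ f, Unmatched M f → (t : ℕ∞) < tenacity M f
  base : ∀ τ < t, UniqueBase M τ
  edge : ∀ θ < t, EdgeClosed M θ

lemma Stage.free_of_le {t τ : ℕ} (h : Stage M t) (hτ : τ ≤ t) :
    ∀ f, Unmatched M f → (τ : ℕ∞) < tenacity M f := fun f hf =>
  lt_of_le_of_lt (by exact_mod_cast hτ) (h.free f hf)

/-- An even level path to `x` extends along an unmatched edge `xy`, or else passes through `y`. -/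
lemma lev_one_le_or_lev_zero_lt {x y : V} (hadj : G.Adj x y) (hxy : ¬ M.Adj x y)
    (hx : lev M 0 x ≠ ⊤) : lev M 1 y ≤ lev M 0 x + 1 ∨ lev M 0 y < lev M 0 x := by
  obtain ⟨n, P, hP, rfl, hn, hl⟩ := exists_isLev hx
  have hn : Even n := by simpa using hn
  rw [← hl]
  by_cases h : ∀ i ≤ n, P i ≠ y
  · left
    have h1 := (hP.1.snoc h hadj (by simp [hxy, hn])).lev_le
    simp only [if_neg (show ¬ n + 1 ≤ n by omega)] at h1
    rw [lev_congr (n := n + 1) (by simp [Nat.even_add_one, hn])]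
    exact_mod_cast h1
  · push Not at h
    obtain ⟨i, hi, rfl⟩ := h
    have h1 := (hP.1.take hi).lev_le
    by_cases hie : Even i
    · right
      rw [lev_congr (n := i) (by simp [hie])]
      refine lt_of_le_of_lt h1 ?_
      have : i ≠ n := fun h => G.loopless.irrefl _ (h ▸ hadj)
      exact_mod_cast lt_of_le_of_ne hi this
    · left
      rw [lev_congr (n := i) (by simp [hie])]
      refine h1.trans ?_
      exact_mod_cast (by omega : i ≤ n + 1)

lemma tenacity_eq (v : V) : tenacity M v = lev M 0 v + lev M 1 v := tenacity_eq_lev 0 v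

lemma baseAt_mate_ne (hM : M.IsMatching) {τ : ℕ}
    (hU : UniqueBase M τ) (hfree : ∀ f, Unmatched M f → (τ : ℕ∞) < tenacity M f)
    (x y : V) (h : M.Adj x y) (hx : baseAt M τ x ≠ x) :
    baseAt M τ y = baseAt M τ x ∧ baseAt M τ y ≠ y := by
  rw [Ne, baseAt_eq_self_iff hfree, not_lt] at hx
  refine ⟨(baseAt_mate hM hU h hx hfree).symm, ?_⟩
  rwa [Ne, baseAt_eq_self_iff hfree, not_lt, ← tenacity_mate hM h]

section Dual

variable [DecidableEq V]

/-- The number of thresholds below `t` for which `x` and `y` lie in the same blossom; twice this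
number is the total of the doubled dual variables of the blossoms containing both. -/
noncomputable def commonBlossoms (M : G.Subgraph) (t : ℕ) (x y : V) : ℕ :=
  ((Finset.range t).filter fun τ => baseAt M τ x = baseAt M τ y).card

/-- The doubled dual variable of a vertex. -/
noncomputable def potential (M : G.Subgraph) (t : ℕ) (v : V) : ℤ :=
  dualValue t (lev M 0 v) (lev M 1 v)

/-- Dual feasibility at unmatched edges. -/
lemma Stage.potential_add_le {t : ℕ} (h : Stage M t) {x y : V} (hadj : G.Adj x y)
    (hxy : ¬ M.Adj x y) :
    potential M t x + potential M t y ≤ 2 + 2 * commonBlossoms M t x y := by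
  refine dualValue_add_le (lev_one_le_or_lev_zero_lt hadj hxy)
    (lev_one_le_or_lev_zero_lt hadj.symm fun h' => hxy h'.symm) fun θ hθ hθt => ?_
  have hclosed := h.edge θ hθt x y hadj hxy hθ
  have hsub : Finset.Ico θ t ⊆
      (Finset.range t).filter fun τ => baseAt M τ x = baseAt M τ y := by
    intro τ hτ
    obtain ⟨h1, h2⟩ := Finset.mem_Ico.1 hτ
    refine Finset.mem_filter.2 ⟨Finset.mem_range.2 h2, ?_⟩
    rw [← baseAt_baseAt h1 (h.base θ hθt) (h.base τ h2) (h.free_of_le h2.le) x, hclosed,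
      baseAt_baseAt h1 (h.base θ hθt) (h.base τ h2) (h.free_of_le h2.le) y]
  have := Finset.card_le_card hsub
  rw [Nat.card_Ico] at this
  unfold commonBlossoms
  omega

/-- Dual feasibility at matched edges, where the constraint is subtracted along a path. -/
lemma le_potential_add (hM : M.IsMatching) {t : ℕ} {x y : V}
    (hxy : M.Adj x y) :
    2 * (commonBlossoms M t x y : ℤ) ≤ 2 + (potential M t x + potential M t y) := by
  have hdiff : ∀ τ : ℕ, (τ : ℕ∞) < tenacity M x → baseAt M τ x ≠ baseAt M τ y := by
    intro τ hτ heq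
    rw [baseAt_of_lt hτ, baseAt_of_lt (by rwa [← tenacity_mate hM hxy])] at heq
    exact M.loopless.irrefl _ (heq ▸ hxy)
  refine le_dualValue_add (lev_mate hM hxy) (lev_mate hM hxy.symm) (fun s hs => ?_) fun hlt => ?_
  · have hsub : (Finset.range t).filter (fun τ => baseAt M τ x = baseAt M τ y) ⊆
        Finset.Ico s t := by
      intro τ hτ
      obtain ⟨h1, h2⟩ := Finset.mem_filter.1 hτ
      refine Finset.mem_Ico.2 ⟨?_, Finset.mem_range.1 h1⟩
      by_contra hcon
      refine hdiff τ ?_ h2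
      rw [tenacity_eq, hs]
      exact_mod_cast not_le.1 hcon
    have := Finset.card_le_card hsub
    rwa [Nat.card_Ico] at this
  · rw [commonBlossoms, Finset.card_eq_zero, Finset.filter_eq_empty_iff]
    intro τ hτ
    refine hdiff τ ?_
    rw [tenacity_eq]
    exact lt_trans (by exact_mod_cast Finset.mem_range.1 hτ) hlt

/-- The length bound given by weak duality: the constraints of the edges, alternately added and
subtracted along the path, telescope. -/
lemma Stage.balance_le (hM : M.IsMatching) {t : ℕ} (h : Stage M t) {n : ℕ} {P : ℕ → V}
    (hP : AltSeq M n P) {i : ℕ} (hi : i ≤ n) :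
    t + (if Even i then -potential M t (P i) else potential M t (P i)) +
      2 * ∑ τ ∈ Finset.range t, balance (baseAt M τ) P i ≤ 2 * (i : ℤ) := by
  induction i with
  | zero =>
    have h0 : lev M 0 (P 0) = 0 := le_antisymm (hP.take (Nat.zero_le n)).lev_le zero_le
    have hp : (t : ℤ) ≤ potential M t (P 0) := by
      have hfree := h.free _ hP.start
      unfold potential dualValue
      rw [tenacity_eq, h0, zero_add] at hfree
      rw [h0, zero_add, mul_zero]
      rcases Nat.eq_zero_or_pos t with rfl | ht
      · simp
      · rw [if_pos (Or.inr (by exact_mod_cast ht))]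
        simp
    simp only [balance, Finset.range_zero, Finset.sum_empty, Finset.sum_const_zero]
    simpa using hp
  | succ i ih =>
    have ih := ih (by omega)
    have hsum : ∑ τ ∈ Finset.range t, balance (baseAt M τ) P (i + 1) =
        ∑ τ ∈ Finset.range t, balance (baseAt M τ) P i +
          (if Odd i then 1 else -1) * commonBlossoms M t (P i) (P (i + 1)) := by
      rw [commonBlossoms, Finset.card_filter, Nat.cast_sum, Finset.mul_sum,
        ← Finset.sum_add_distrib]
      refine Finset.sum_congr rfl fun τ _ => ?_
      rw [balance, Finset.sum_range_succ, ← balance]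
      split_ifs <;> simp
    rw [hsum]
    by_cases hodd : Odd i
    · have he : ¬ Even i := Nat.not_even_iff_odd.2 hodd
      have h1 := le_potential_add hM (t := t) ((hP.alt i (by omega)).2 hodd)
      rw [if_neg he] at ih
      rw [if_pos (Nat.even_add_one.2 he), if_pos hodd]
      push_cast
      linarith
    · have he : Even i := Nat.not_odd_iff_even.1 hodd
      have h1 := h.potential_add_le (hP.adj i (by omega)) (mt (hP.alt i (by omega)).1 hodd)
      rw [if_pos he] at ih
      rw [if_neg (by rw [Nat.even_add_one, not_not]; exact he), if_neg hodd]
      push_cast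
      linarith

lemma excess_baseAt_nonneg (hM : M.IsMatching) {τ : ℕ}
    (hU : UniqueBase M τ) (hfree : ∀ f, Unmatched M f → (τ : ℕ∞) < tenacity M f)
    {n : ℕ} {P : ℕ → V} (hP : AltSeq M n P) : 0 ≤ excess (baseAt M τ) P n :=
  hP.excess_nonneg (baseAt_mate_ne hM hU hfree) (baseAt_of_lt (hfree _ hP.start))

/-- Level paths are tight for the dual potential, so they traverse every blossom in the cheapest
possible way. The condition `hact` says that the dual variable of the end vertex has started to
reflect the level that the path realises. -/
lemma Stage.tight (hM : M.IsMatching) {t : ℕ} (h : Stage M t) {n : ℕ} {P : ℕ → V}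
    (hP : IsLev M n P) (hact : tenacity M (P n) ≤ t ∨ 2 * n < t) {τ : ℕ} (hτ : τ < t) :
    excess (baseAt M τ) P n = 0 ∧ missedBases (baseAt M τ) P n = ∅ := by
  have hmain := h.balance_le hM hP.1 le_rfl
  have hbal : ∑ τ ∈ Finset.range t, balance (baseAt M τ) P n =
      ∑ τ ∈ Finset.range t, (excess (baseAt M τ) P n + (missedBases (baseAt M τ) P n).card) -
        ((Finset.range t).filter fun τ => Odd n ∧ baseAt M τ (P n) ≠ P n).card := by
    rw [Finset.card_filter, Nat.cast_sum, ← Finset.sum_sub_distrib]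
    refine Finset.sum_congr rfl fun σ _ => ?_
    unfold excess
    push_cast
    ring
  have hnn : ∀ σ ∈ Finset.range t,
      0 ≤ excess (baseAt M σ) P n + ((missedBases (baseAt M σ) P n).card : ℤ) := fun σ hσ => by
    have hσ := Finset.mem_range.1 hσ
    have := excess_baseAt_nonneg hM (h.base σ hσ) (h.free_of_le hσ.le) hP.1
    positivity
  -- the bound given by the potential is attained, hence nothing is wasted on any blossom
  have hzero : ∑ σ ∈ Finset.range t,
      (excess (baseAt M σ) P n + ((missedBases (baseAt M σ) P n).card : ℤ)) ≤ 0 := by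
    have hlev := hP.2
    by_cases hn : Even n
    · have hlev0 : lev M 0 (P n) = n := by rw [← hlev]; exact lev_congr (by simp [hn]) _
      have hB : ((Finset.range t).filter fun τ => Odd n ∧ baseAt M τ (P n) ≠ P n) = ∅ := by
        simp [Nat.not_odd_iff_even.2 hn]
      have hpot : potential M t (P n) = t - 2 * n := by
        unfold potential dualValue
        rw [tenacity_eq, hlev0] at hact
        rw [hlev0, if_pos (hact.imp_right fun h => by exact_mod_cast h), ENat.toNat_natCast]
      rw [hbal, if_pos hn, hpot, hB, Finset.card_empty] at hmain
      push_cast at hmain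
      linarith
    · have hodd := Nat.not_even_iff_odd.1 hn
      have hlev1 : lev M 1 (P n) = n := by rw [← hlev]; exact lev_congr (by simp [hodd]) _
      rw [if_neg hn, hbal] at hmain
      rcases le_or_gt (tenacity M (P n)) t with hle | hgt
      · obtain ⟨e, he⟩ := ENat.ne_top_iff_exists.1 (show lev M 0 (P n) ≠ ⊤ from fun htop => by
          rw [tenacity_eq, htop, top_add] at hle
          exact absurd (top_le_iff.1 hle) (ENat.natCast_ne_top t))
        have hten : tenacity M (P n) = (e + n : ℕ) := by
          rw [tenacity_eq, ← he, hlev1]; push_cast; rfl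
        have hent : e + n ≤ t := by rw [hten] at hle; exact_mod_cast hle
        have hB : ((Finset.range t).filter fun τ => Odd n ∧ baseAt M τ (P n) ≠ P n).card ≤
            t - (e + n) := by
          rw [← Nat.card_Ico]
          refine Finset.card_le_card fun σ hσ => ?_
          obtain ⟨h1, -, h2⟩ := Finset.mem_filter.1 hσ
          refine Finset.mem_Ico.2 ⟨?_, Finset.mem_range.1 h1⟩
          by_contra hcon
          refine h2 (baseAt_of_lt ?_)
          rw [hten]
          exact_mod_cast not_le.1 hcon
        have hpot : potential M t (P n) = t - 2 * e := by
          unfold potential dualValue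
          rw [← tenacity_eq, if_pos (Or.inl hle), ← he, ENat.toNat_natCast]
        rw [hpot] at hmain
        omega
      · have h2n : 2 * n < t := hact.resolve_left (not_le.2 hgt)
        have hB : ((Finset.range t).filter fun τ => Odd n ∧ baseAt M τ (P n) ≠ P n) = ∅ := by
          rw [Finset.filter_eq_empty_iff]
          rintro σ hσ ⟨-, h2⟩
          exact h2 (baseAt_of_lt (lt_trans (by exact_mod_cast Finset.mem_range.1 hσ) hgt))
        have hpot : potential M t (P n) = 2 * n - t := by
          unfold potential dualValue
          rw [← tenacity_eq, hlev1, if_neg, if_pos (by exact_mod_cast h2n), ENat.toNat_natCast]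
          rintro (h1 | h1)
          · exact absurd hgt (not_lt.2 h1)
          · rw [tenacity_eq, hlev1] at hgt
            obtain ⟨e, he⟩ := ENat.ne_top_iff_exists.1 (show lev M 0 (P n) ≠ ⊤ from fun htop => by
              rw [htop] at h1
              simp at h1)
            rw [← he] at h1 hgt
            have h1 : 2 * e < t := by exact_mod_cast h1
            have hgt : t < e + n := by exact_mod_cast hgt
            omega
        rw [hpot, hB, Finset.card_empty] at hmain
        push_cast at hmain
        linarith
  have hall := (Finset.sum_eq_zero_iff_of_nonneg hnn).1
    (le_antisymm hzero (Finset.sum_nonneg hnn)) τ (Finset.mem_range.2 hτ)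
  have h1 := excess_baseAt_nonneg hM (h.base τ hτ) (h.free_of_le hτ.le) hP.1
  refine ⟨by omega, Finset.card_eq_zero.1 (by omega)⟩

/-- Tight paths contain the base of each of their vertices. -/
lemma Stage.exists_eq_baseAt (hM : M.IsMatching) {t : ℕ} (h : Stage M t) {n : ℕ} {P : ℕ → V}
    (hP : IsLev M n P) (hact : tenacity M (P n) ≤ t ∨ 2 * n < t) {τ : ℕ} (hτ : τ < t) {i : ℕ}
    (hi : i ≤ n) : ∃ j ≤ n, P j = baseAt M τ (P i) :=
  exists_eq_of_missedBases_eq_empty (h.tight hM hP hact hτ).2 hi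

/-- Tight paths traverse each blossom in one stretch. -/
lemma Stage.contiguous (hM : M.IsMatching) {t : ℕ} (h : Stage M t) {n : ℕ} {P : ℕ → V}
    (hP : IsLev M n P) (hact : tenacity M (P n) ≤ t ∨ 2 * n < t) {τ : ℕ} (hτ : τ < t) {i j k : ℕ}
    (hij : i ≤ j) (hjk : j ≤ k) (hk : k ≤ n) (heq : baseAt M τ (P i) = baseAt M τ (P k)) :
    baseAt M τ (P j) = baseAt M τ (P k) :=
  hP.1.contiguous (baseAt_mate_ne hM (h.base τ hτ) (h.free_of_le hτ.le))
    (baseAt_of_lt (h.free_of_le hτ.le _ hP.1.start)) (h.tight hM hP hact hτ).1 hij hjk hk heq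

end Dual

/-! ### Uniqueness of bases -/

lemma natCast_le_of_pred_lt {t : ℕ} {x : ℕ∞} (h : ((t - 1 : ℕ) : ℕ∞) < x) : (t : ℕ∞) ≤ x := by
  have h1 := Order.add_one_le_of_lt h
  refine le_trans ?_ h1
  exact_mod_cast (by omega : t ≤ t - 1 + 1)

lemma pred_lt_of_natCast_le {t : ℕ} (ht : 1 ≤ t) {x : ℕ∞} (h : (t : ℕ∞) ≤ x) :
    ((t - 1 : ℕ) : ℕ∞) < x :=
  lt_of_lt_of_le (by exact_mod_cast (by omega : t - 1 < t)) h

/-- Positions of different parity at which a vertex is honest add up to its tenacity, so below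
that bound the positions agree. -/
lemma eq_of_add_lt_tenacity {i j : ℕ} {v : V} (hi : lev M i v = i) (hj : lev M j v = j)
    (h : ((i + j : ℕ) : ℕ∞) < tenacity M v) : i = j := by
  by_cases hpar : Even i ↔ Even j
  · rw [lev_congr hpar, hj] at hi
    exact_mod_cast hi.symm
  · have h1 : lev M (i + 1) v = j := by
      rw [← hj]
      refine lev_congr ?_ v
      rw [Nat.even_add_one]
      tauto
    rw [tenacity_eq_lev i, hi, h1] at h
    exact absurd h (by push_cast; exact lt_irrefl _)

/-- Two honest paths have the same last vertex of tenacity exceeding `t` as soon as each of these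
two vertices lies on the other path. -/
lemma eq_of_mem_of_mem {t n m : ℕ} {P Q : ℕ → V} (hP : AltSeq M n P) (hQ : AltSeq M m Q)
    (hfree : ∀ f, Unmatched M f → (t : ℕ∞) < tenacity M f) (hnm : n + m ≤ t)
    (honP : ∀ k ≤ n, (t : ℕ∞) ≤ tenacity M (P k) → lev M k (P k) = k)
    (honQ : ∀ k ≤ m, (t : ℕ∞) ≤ tenacity M (Q k) → lev M k (Q k) = k)
    (h1 : ∃ j ≤ m, Q j = P (lastPos M t n P)) (h2 : ∃ i ≤ n, P i = Q (lastPos M t m Q)) :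
    P (lastPos M t n P) = Q (lastPos M t m Q) := by
  have key : ∀ {n m : ℕ} {P Q : ℕ → V}, AltSeq M n P → n + m ≤ t →
      (∀ k ≤ n, (t : ℕ∞) ≤ tenacity M (P k) → lev M k (P k) = k) →
      (∀ k ≤ m, (t : ℕ∞) ≤ tenacity M (Q k) → lev M k (Q k) = k) →
      ∀ j ≤ m, Q j = P (lastPos M t n P) →
        j = lastPos M t n P ∧ j ≤ lastPos M t m Q := by
    intro n m P Q hP hnm honP honQ j hj hQj
    have hlt := hP.lt_tenacity_lastPos hfree
    have hle := lastPos_le (M := M) t n P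
    refine ⟨?_, le_lastPos hj (by rwa [hQj])⟩
    refine eq_of_add_lt_tenacity (v := P (lastPos M t n P)) ?_ (honP _ hle hlt.le) ?_
    · rw [← hQj]; exact honQ j hj (by rw [hQj]; exact hlt.le)
    · exact lt_of_le_of_lt (by exact_mod_cast (by omega)) hlt
  obtain ⟨j, hj, hQj⟩ := h1
  obtain ⟨i, hi, hPi⟩ := h2
  obtain ⟨h3, h4⟩ := key hP hnm honP honQ j hj hQj
  obtain ⟨h5, h6⟩ := key hQ (by omega) honQ honP i hi hPi
  rw [← hQj, show j = lastPos M t m Q by omega]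

/-- The last vertex of tenacity exceeding `t` on `P` lies on `Q`, once a common vertex of tenacity
at least `t` after it is known, provided that level paths of common vertices of tenacity `t`
have the same base. -/
lemma mem_of_common_high {t n m : ℕ} {P Q : ℕ → V} (hP : AltSeq M n P)
    (hfree : ∀ f, Unmatched M f → (t : ℕ∞) < tenacity M f)
    (honP : ∀ k ≤ n, (t : ℕ∞) ≤ tenacity M (P k) → lev M k (P k) = k)
    (honQ : ∀ k ≤ m, (t : ℕ∞) ≤ tenacity M (Q k) → lev M k (Q k) = k)
    {i j : ℕ} (hi : i ≤ n) (hj : j ≤ m) (hij : Q j = P i) (hlast : lastPos M t n P ≤ i)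
    (hhigh : (t : ℕ∞) ≤ tenacity M (P i)) (hlt : ((i + j : ℕ) : ℕ∞) < tenacity M (P i))
    (hrec : i = j → tenacity M (P i) = t → P (lastPos M t i P) = Q (lastPos M t i Q)) :
    ∃ j ≤ m, Q j = P (lastPos M t n P) := by
  have heq : i = j := eq_of_add_lt_tenacity (honP i hi hhigh)
    (by rw [← hij]; exact honQ j hj (by rwa [hij])) hlt
  rcases hhigh.lt_or_eq with h1 | h1
  · have := le_lastPos hi h1
    exact ⟨j, hj, by rw [hij, show i = lastPos M t n P by omega]⟩
  · have h2 := hrec heq h1.symm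
    rw [hP.lastPos_take hfree hi hlast] at h2
    exact ⟨lastPos M t i Q, (lastPos_le _ _ _).trans (by omega), h2.symm⟩

section

variable [DecidableEq V]

/-- If two tight paths meet, they also meet at the base of the blossom of the meeting point, and
this base is not before the last vertex of tenacity exceeding `t`. -/
lemma Stage.exists_common_base (hM : M.IsMatching) {t : ℕ} (h : Stage M t) (ht : 1 ≤ t) {n m : ℕ}
    {P Q : ℕ → V} (hP : IsLev M n P) (hactP : tenacity M (P n) ≤ t ∨ 2 * n < t)
    (hQ : IsLev M m Q) (hactQ : tenacity M (Q m) ≤ t ∨ 2 * m < t) {i j : ℕ} (hi : i ≤ n)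
    (hj : j ≤ m) (hij : Q j = P i) (hlast : lastPos M t n P ≤ i) :
    ∃ i' ≤ n, ∃ j' ≤ m, Q j' = P i' ∧ P i' = baseAt M (t - 1) (P i) ∧ lastPos M t n P ≤ i' := by
  have hlt : t - 1 < t := by omega
  obtain ⟨i', hi', hPi'⟩ := h.exists_eq_baseAt hM hP hactP hlt hi
  obtain ⟨j', hj', hQj'⟩ := h.exists_eq_baseAt hM hQ hactQ hlt hj
  refine ⟨i', hi', j', hj', by rw [hQj', hPi', hij], hPi', ?_⟩
  by_contra hcon
  push Not at hcon
  have h1 := h.contiguous hM hP hactP hlt hcon.le hlast hi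
    (by rw [hPi', baseAt_idem (h.free_of_le hlt.le)])
  rw [baseAt_of_lt (lt_of_le_of_lt (by exact_mod_cast hlt.le)
    (hP.1.lt_tenacity_lastPos h.free)), ← hPi'] at h1
  have := hP.1.inj _ _ (lastPos_le _ _ _) hi' h1
  omega

/-- An even tight path leaves its last blossom before reaching an end vertex of tenacity at
least `t`, because the mate of the end has the same tenacity. -/
lemma Stage.baseAt_ne_end (hM : M.IsMatching) {t : ℕ} (h : Stage M t) (ht : 1 ≤ t) {n : ℕ}
    {P : ℕ → V} (hP : IsLev M n P) (hactP : tenacity M (P n) ≤ t ∨ 2 * n < t)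
    (hhigh : (t : ℕ∞) ≤ tenacity M (P n)) (hn : Even n) {i : ℕ} (hi : i < n) :
    baseAt M (t - 1) (P i) ≠ P n := by
  intro heq
  obtain _ | k := n
  · omega
  have hk : Odd k := by
    rw [Nat.even_add_one, Nat.not_even_iff_odd] at hn; exact hn
  have hadj := (hP.1.alt k (by omega)).2 hk
  have hlt := pred_lt_of_natCast_le ht hhigh
  have h1 := h.contiguous hM hP hactP (τ := t - 1) (by omega) (show i ≤ k by omega)
    (Nat.le_succ k) le_rfl (by rw [heq, baseAt_of_lt hlt])
  rw [baseAt_of_lt hlt, baseAt_of_lt (by rwa [tenacity_mate hM hadj])] at h1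
  have := hP.1.inj k (k + 1) (by omega) le_rfl h1
  omega

/-- Level paths of opposite parities of a vertex of tenacity `t` have the same base. -/
lemma Stage.eq_of_opposite (hM : M.IsMatching) {t : ℕ} (h : Stage M t) (k : ℕ) :
    ∀ n P m Q, min n m < k → IsLev M n P → IsLev M m Q → P n = Q m → ¬(Even n ↔ Even m) →
      tenacity M (P n) = t → P (lastPos M t n P) = Q (lastPos M t m Q) := by
  induction k with
  | zero => intro n P m Q hk; omega
  | succ k ih =>
    intro n P m Q hk hP hQ hPQ hpar hten
    have hsum : ∀ {n m : ℕ} {P Q : ℕ → V}, IsLev M n P → IsLev M m Q → P n = Q m →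
        ¬(Even n ↔ Even m) → tenacity M (P n) = t → n + m = t := by
      intro n m P Q hP hQ hPQ hpar hten
      rw [tenacity_eq_lev n, hP.2, lev_congr (m := n + 1) (n := m)
        (by rw [Nat.even_add_one]; tauto), hPQ, hQ.2] at hten
      exact_mod_cast hten
    have hon : ∀ {n : ℕ} {P : ℕ → V}, IsLev M n P → tenacity M (P n) = t →
        ∀ i ≤ n, (t : ℕ∞) ≤ tenacity M (P i) → lev M i (P i) = i := fun hP hten i hi hle =>
      hP.lev_eq hi (by rw [hten]; exact ENat.natCast_ne_top t) (by rwa [hten])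
    have half : ∀ n P m Q, min n m < k + 1 → IsLev M n P → IsLev M m Q → P n = Q m →
        ¬(Even n ↔ Even m) → tenacity M (P n) = t → ∃ j ≤ m, Q j = P (lastPos M t n P) := by
      intro n P m Q hk hP hQ hPQ hpar hten
      have hnm := hsum hP hQ hPQ hpar hten
      have ht : 1 ≤ t := by
        by_contra h0
        obtain ⟨rfl, rfl⟩ : n = 0 ∧ m = 0 := by omega
        exact hpar Iff.rfl
      have htenQ : tenacity M (Q m) = t := hPQ ▸ hten
      have hbig := hP.1.lt_tenacity_lastPos h.free
      obtain ⟨j, hj, i, hui, hin, hij, hpar'⟩ := hP.exists_common hQ.1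
        (hP.take_lastPos h.free hten.le).2 (by rwa [hnm])
        ⟨m, le_rfl, n, lastPos_le _ _ _, le_rfl, hPQ.symm⟩
      obtain ⟨i', hi', j', hj', hij', hbase, hlast⟩ :=
        h.exists_common_base hM ht hP (Or.inl hten.le) hQ (Or.inl htenQ.le) hin hj hij hui
      have hhigh : (t : ℕ∞) ≤ tenacity M (P i') := natCast_le_of_pred_lt
        (hbase ▸ lt_tenacity_baseAt (h.free_of_le (Nat.sub_le t 1)) (P i))
      -- the common base is not the common end: the even one of the two paths excludes that
      have hne : P i' ≠ P n := by
        intro heq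
        rw [heq] at hbase
        have hin' : i ≠ n := by
          rintro rfl
          have := hQ.1.inj j m hj le_rfl (hij.trans hPQ)
          subst this
          exact hpar hpar'
        have hjm : j ≠ m := by
          rintro rfl
          exact hin' (hP.1.inj i n hin le_rfl (hij.symm.trans hPQ.symm))
        by_cases hn : Even n
        · exact h.baseAt_ne_end hM ht hP (Or.inl hten.le) hten.ge hn
            (lt_of_le_of_ne hin hin') hbase.symm
        · have hm : Even m := by tauto
          exact h.baseAt_ne_end hM ht hQ (Or.inl htenQ.le) htenQ.ge hm
            (lt_of_le_of_ne hj hjm) (by rw [hij, ← hbase, hPQ])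
      have hin' : i' < n := lt_of_le_of_ne hi' fun heq => hne (by rw [heq])
      have hjm' : j' < m := lt_of_le_of_ne hj' fun heq => hne (by rw [← hij', heq, hPQ])
      refine mem_of_common_high hP.1 h.free (hon hP hten) (hon hQ htenQ) hi' hj' hij' hlast hhigh
        (lt_of_lt_of_le (by exact_mod_cast (by omega : i' + j' < t)) hhigh) fun heq hten' => ?_
      subst heq
      -- compare both initial parts with a level path of the other parity
      have hP' : IsLev M i' P := hP.take hi' (hon hP hten i' hi' hhigh)
      have hQ' : IsLev M i' Q := hQ.take hj' (hon hQ htenQ i' hj' (by rwa [hij']))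
      obtain ⟨r, R, hR, hRr, hrpar, -⟩ := exists_isLev_of_tenacity_ne_top (M := M) (v := P i')
        (i' + 1) (by rw [hten']; exact ENat.natCast_ne_top t)
      have hpar'' : ¬(Even i' ↔ Even r) := by
        rw [Nat.even_add_one] at hrpar; tauto
      rw [ih i' P r R (by omega) hP' hR hRr.symm hpar'' hten',
        ih i' Q r R (by omega) hQ' hR (hij'.trans hRr.symm) hpar'' (by rw [hij', hten'])]
    refine eq_of_mem_of_mem hP.1 hQ.1 h.free (hsum hP hQ hPQ hpar hten).le (hon hP hten)
      (hon hQ (hPQ ▸ hten)) (half n P m Q hk hP hQ hPQ hpar hten)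
      (half m Q n P (by rwa [min_comm]) hQ hP hPQ.symm (by tauto) (hPQ ▸ hten))

/-- Level paths of equal parity are compared with one of the other parity, and a vertex of smaller
tenacity with its base for the threshold `t - 1`. -/
lemma Stage.uniqueBase (hM : M.IsMatching) {t : ℕ} (h : Stage M t) : UniqueBase M t := by
  have hge : ∀ n P m Q, IsLev M n P → IsLev M m Q → P n = Q m → (t : ℕ∞) ≤ tenacity M (P n) →
      P (lastPos M t n P) = Q (lastPos M t m Q) := by
    intro n P m Q hP hQ hPQ hle
    rcases hle.lt_or_eq with hlt | heq
    · rw [lastPos_self hlt, lastPos_self (by rwa [← hPQ]), hPQ]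
    · by_cases hpar : Even n ↔ Even m
      · obtain ⟨r, R, hR, hRr, hrpar, -⟩ := exists_isLev_of_tenacity_ne_top (M := M) (v := P n)
          (n + 1) (by rw [← heq]; exact ENat.natCast_ne_top t)
        rw [Nat.even_add_one] at hrpar
        rw [h.eq_of_opposite hM _ n P r R (Nat.lt_succ_self _) hP hR hRr.symm (by tauto) heq.symm,
          h.eq_of_opposite hM _ m Q r R (Nat.lt_succ_self _) hQ hR (hPQ.symm.trans hRr.symm)
            (by tauto) (by rw [← hPQ, heq])]
      · exact h.eq_of_opposite hM _ n P m Q (Nat.lt_succ_self _) hP hQ hPQ hpar heq.symm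
  intro n P m Q hP hQ hPQ
  rcases le_or_gt (t : ℕ∞) (tenacity M (P n)) with hle | hlt
  · exact hge n P m Q hP hQ hPQ hle
  · obtain ⟨s, hs⟩ := ENat.ne_top_iff_exists.1 (ne_top_of_lt hlt)
    have hst : s < t := by rw [← hs] at hlt; exact_mod_cast hlt
    have hsle : tenacity M (P n) ≤ (t - 1 : ℕ) := by
      rw [← hs]; exact_mod_cast (by omega : s ≤ t - 1)
    have hfree := h.free_of_le (Nat.sub_le t 1)
    have hanti : ∀ {n : ℕ} {P : ℕ → V}, AltSeq M n P →
        lastPos M t (lastPos M (t - 1) n P) P = lastPos M t n P := fun hP =>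
      hP.lastPos_take h.free (lastPos_le _ _ _) (lastPos_anti (Nat.sub_le t 1) hP h.free)
    rw [← hanti hP.1, ← hanti hQ.1]
    exact hge _ P _ Q (hP.take_lastPos hfree hsle) (hQ.take_lastPos hfree (by rwa [← hPQ]))
      (h.base (t - 1) (by omega) n P m Q hP hQ hPQ)
      (natCast_le_of_pred_lt (hP.1.lt_tenacity_lastPos hfree))

/-- Even level paths to the two ends of an unmatched edge of tenacity `t` are compared as two level
paths of opposite parity of one vertex of tenacity `t` are. -/
lemma Stage.edgeClosed (hM : M.IsMatching) {t : ℕ} (h : Stage M t) : EdgeClosed M t := by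
  intro x y hadj hxy hsum
  have hU := h.uniqueBase hM
  have hx : lev M 0 x ≠ ⊤ := by
    intro h0; rw [h0, top_add, top_add] at hsum; exact absurd hsum (ENat.top_ne_natCast t)
  have hy : lev M 0 y ≠ ⊤ := by
    intro h0; rw [h0, add_top, top_add] at hsum; exact absurd hsum (ENat.top_ne_natCast t)
  obtain ⟨n, P, hP, rfl, hn, hnl⟩ := exists_isLev hx
  obtain ⟨m, Q, hQ, rfl, hm, hml⟩ := exists_isLev hy
  have hn : Even n := by simpa using hn
  have hm : Even m := by simpa using hm
  rw [← hnl, ← hml] at hsum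
  have hsum : n + m + 1 = t := by exact_mod_cast hsum
  have act : ∀ {n m : ℕ} {P Q : ℕ → V}, IsLev M n P → IsLev M m Q → Even n → Even m →
      G.Adj (P n) (Q m) → ¬ M.Adj (P n) (Q m) → n + m + 1 = t →
      tenacity M (P n) ≤ t ∨ 2 * n < t := by
    intro n m P Q hP hQ hn hm hadj hxy hsum
    have e1 : lev M 0 (P n) = n := by rw [← hP.2]; exact lev_congr (by simp [hn]) _
    have e2 : lev M 0 (Q m) = m := by rw [← hQ.2]; exact lev_congr (by simp [hm]) _
    by_cases h2 : 2 * n < t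
    · exact Or.inr h2
    · left
      rcases lev_one_le_or_lev_zero_lt hadj.symm (fun h' => hxy h'.symm)
        (by rw [e2]; exact ENat.natCast_ne_top m) with h3 | h3
      · rw [tenacity_eq, e1]
        rw [e2] at h3
        calc (n : ℕ∞) + lev M 1 (P n) ≤ n + (m + 1) := by gcongr
          _ = t := by rw [← hsum]; push_cast; ring
      · rw [e1, e2] at h3
        have h3 : n < m := by exact_mod_cast h3
        omega
  have hon : ∀ {n : ℕ} {P : ℕ → V}, IsLev M n P → (tenacity M (P n) ≤ t ∨ 2 * n < t) →
      ∀ i ≤ n, (t : ℕ∞) ≤ tenacity M (P i) → lev M i (P i) = i := by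
    rintro n P hP (hact | hact) i hi hle
    · exact hP.lev_eq hi (ne_top_of_le_ne_top (ENat.natCast_ne_top t) hact) (hact.trans hle)
    · by_contra hne
      obtain ⟨-, -, -, hlt⟩ := hP.tenacity_lt_of_lev_ne hi hne
      have : t < n + i := by exact_mod_cast hle.trans_lt hlt
      omega
  have half : ∀ {n m : ℕ} {P Q : ℕ → V}, IsLev M n P → IsLev M m Q → Even n → Even m →
      G.Adj (P n) (Q m) → ¬ M.Adj (P n) (Q m) → n + m + 1 = t →
      ∃ j ≤ m, Q j = P (lastPos M t n P) := by
    intro n m P Q hP hQ hn hm hadj hxy hsum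
    have hactP := act hP hQ hn hm hadj hxy hsum
    have hactQ := act hQ hP hm hn hadj.symm (fun h' => hxy h'.symm) (by omega)
    have hbig := hP.1.lt_tenacity_lastPos h.free
    have hule := lastPos_le (M := M) t n P
    have hlev := hon hP hactP _ hule hbig.le
    -- otherwise `Q`, the edge and the final part of `P` would give a short odd path
    obtain ⟨j, hj, i, hui, hin, hij⟩ : ∃ j ≤ m, ∃ i, lastPos M t n P ≤ i ∧ i ≤ n ∧ Q j = P i := by
      by_cases hmeet : ∃ j ≤ m, Q j = P n
      · obtain ⟨j, hj, hij⟩ := hmeet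
        exact ⟨j, hj, n, hule, le_rfl, hij⟩
      · push Not at hmeet
        have hQ' := hQ.1.snoc hmeet hadj.symm
          (by simp [mt M.adj_symm hxy, Nat.not_odd_iff_even.2 hm])
        obtain ⟨j, hj, i, hui, hin, hij, hpar⟩ := hP.exists_common hQ' hlev
          (by rw [← add_assoc, hsum]; exact hbig)
          ⟨m + 1, le_rfl, n, hule, le_rfl, by simp⟩
        rcases Nat.lt_or_ge m j with h1 | h1
        · obtain rfl : j = m + 1 := by omega
          simp only [if_neg (show ¬ m + 1 ≤ m by omega)] at hij
          have := hP.1.inj n i le_rfl hin hij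
          subst this
          rw [Nat.even_add_one] at hpar
          tauto
        · exact ⟨j, h1, i, hui, hin, by simpa [h1] using hij⟩
    have ht : 1 ≤ t := by omega
    obtain ⟨i', hi', j', hj', hij', hbase, hlast⟩ :=
      h.exists_common_base hM ht hP hactP hQ hactQ hin hj hij hui
    have hhigh : (t : ℕ∞) ≤ tenacity M (P i') := natCast_le_of_pred_lt
      (hbase ▸ lt_tenacity_baseAt (h.free_of_le (Nat.sub_le t 1)) (P i))
    refine mem_of_common_high hP.1 h.free (hon hP hactP) (hon hQ hactQ) hi' hj' hij' hlast hhigh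
      (lt_of_lt_of_le (by exact_mod_cast (by omega : i' + j' < t)) hhigh) fun heq _ => ?_
    subst heq
    exact hU _ _ _ _ (hP.take hi' (hon hP hactP i' hi' hhigh))
      (hQ.take hj' (hon hQ hactQ i' hj' (by rwa [hij']))) hij'.symm
  have hadj' := hadj.symm
  have hxy' : ¬ M.Adj (Q m) (P n) := fun h' => hxy h'.symm
  rw [hU.baseAt_eq hP, hU.baseAt_eq hQ]
  exact eq_of_mem_of_mem hP.1 hQ.1 h.free (by omega)
    (hon hP (act hP hQ hn hm hadj hxy hsum)) (hon hQ (act hQ hP hm hn hadj' hxy' (by omega)))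
    (half hP hQ hn hm hadj hxy hsum) (half hQ hP hm hn hadj' hxy' (by omega))

/-- The simultaneous induction on `t` behind the uniqueness of bases. -/
theorem stage_of_free (hM : M.IsMatching) (t : ℕ)
    (hfree : ∀ f, Unmatched M f → (t : ℕ∞) < tenacity M f) : Stage M t := by
  induction t using Nat.strong_induction_on with
  | _ t ih =>
    have hlow : ∀ τ < t, Stage M τ := fun τ hτ => ih τ hτ fun f hf =>
      lt_trans (by exact_mod_cast hτ) (hfree f hf)
    exact ⟨hfree, fun τ hτ => (hlow τ hτ).uniqueBase hM, fun θ hθ => (hlow θ hθ).edgeClosed hM⟩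

end

/-! ### Bases and iterated bases -/

section Walks

variable [DecidableEq V] {f v : V} {p : G.Walk f v}

lemma length_takeUntil_eq (hp : AltSeq M p.length p.getVert) {i : ℕ} (hi : i ≤ p.length) {u : V}
    (hu : u ∈ p.support) (hiu : p.getVert i = u) : (p.takeUntil u hu).length = i :=
  hp.inj _ _ (p.length_takeUntil_le_length hu) hi
    (by rw [SimpleGraph.Walk.getVert_length_takeUntil, hiu])

lemma isBaseWrt_iff (hp : AltSeq M p.length p.getVert) {t : ℕ} (ht : tenacity M v = t)
    (hfree : ∀ f, Unmatched M f → (t : ℕ∞) < tenacity M f) {b : V} :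
    IsBaseWrt M p b ↔ b = p.getVert (lastPos M t p.length p.getVert) := by
  have hle := lastPos_le (M := M) t p.length p.getVert
  have hlt := hp.lt_tenacity_lastPos hfree
  have hmax : ∀ (u : V) (hu : u ∈ p.support), tenacity M v < tenacity M u →
      (p.takeUntil u hu).length ≤ lastPos M t p.length p.getVert := fun u hu hvu =>
    le_lastPos (p.length_takeUntil_le_length hu)
      (by rwa [SimpleGraph.Walk.getVert_length_takeUntil, ← ht])
  constructor
  · rintro ⟨hb, hvb, hb'⟩
    have h1 := hb' _ (p.getVert_mem_support _) (by rw [ht]; exact hlt)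
    rw [length_takeUntil_eq hp hle _ rfl] at h1
    rw [← le_antisymm (hmax b hb hvb) h1, SimpleGraph.Walk.getVert_length_takeUntil]
  · rintro rfl
    refine ⟨p.getVert_mem_support _, by rw [ht]; exact hlt, fun u hu hvu => ?_⟩
    rw [length_takeUntil_eq hp hle _ rfl]
    exact hmax u hu hvu

/-- The base of `v` exists and is the base of its blossom of tenacity `t(v)`. -/
lemma baseSet_eq (hM : M.IsMatching) {t : ℕ} (ht : tenacity M v = t)
    (hlt : tenacity M v < minAugLength M) : baseSet M v = {baseAt M t v} := by
  have hfree : ∀ f, Unmatched M f → (t : ℕ∞) < tenacity M f := fun f hf =>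
    ht ▸ hlt.trans_le (minAugLength_le_tenacity hf)
  have hU := (stage_of_free hM t hfree).uniqueBase hM
  have hbase : ∀ (g : V) (q : G.Walk g v), IsLevelPath M q → ∀ b, IsBaseWrt M q b ↔
      b = baseAt M t v := by
    intro g q hq b
    obtain ⟨-, -, hq⟩ := isLevelPath_iff.1 hq
    rw [isBaseWrt_iff hq.1 ht hfree, ← hU.baseAt_eq hq, q.getVert_length]
  obtain ⟨n, P, hP, hPn, -⟩ := exists_isLev_of_tenacity_ne_top (M := M) (v := v) 0
    (by rw [ht]; exact ENat.natCast_ne_top t)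
  subst hPn
  obtain ⟨q, hqn, hq⟩ := hP.1.exists_walk
  have hlevel : IsLevelPath M q := isLevelPath_iff.2
    ⟨hP.1.start, hq, altSeq_getVert hP.1.start hq, by rw [q.getVert_length, hqn, hP.2]⟩
  ext b
  simp only [baseSet, Set.mem_ofPred_eq, Set.mem_singleton_iff]
  constructor
  · rintro ⟨g, r, hr, hb⟩
    exact (hbase g r hr b).1 hb
  · rintro rfl
    exact ⟨_, q, hlevel, (hbase _ q hlevel _).2 rfl⟩

omit [DecidableEq V] in
lemma exists_tenacity_eq (hlt : tenacity M v < minAugLength M) : ∃ t : ℕ, tenacity M v = t := by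
  obtain ⟨t, ht⟩ := ENat.ne_top_iff_exists.1 (ne_top_of_lt hlt)
  exact ⟨t, ht.symm⟩

lemma IsBase.exists_on_isLev (hM : M.IsMatching) {b : V} {n : ℕ} {P : ℕ → V}
    (hb : IsBase M (P n) b) (hP : IsLev M n P) : ∃ i ≤ n, P i = b ∧ lev M i b = i := by
  obtain ⟨hlt, hset⟩ := hb
  obtain ⟨t, ht⟩ := exists_tenacity_eq hlt
  have hfree : ∀ f, Unmatched M f → (t : ℕ∞) < tenacity M f := fun f hf =>
    ht ▸ hlt.trans_le (minAugLength_le_tenacity hf)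
  rw [baseSet_eq hM ht hlt, Set.singleton_eq_singleton_iff,
    ((stage_of_free hM t hfree).uniqueBase hM).baseAt_eq hP] at hset
  exact ⟨_, lastPos_le _ _ _, hset, hset ▸ (hP.take_lastPos hfree ht.le).2⟩

/-- The part of a level path of `v` up to an honest iterated base is a level path of that base, so
the next base lies on it as well. -/
lemma IsIteratedBase.exists_on_isLev (hM : M.IsMatching) {k : ℕ} {b : V}
    (hb : IsIteratedBase M v k b) {n : ℕ} {P : ℕ → V} (hP : IsLev M n P) (hPn : P n = v) :
    ∃ i ≤ n, P i = b ∧ lev M i b = i := by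
  induction hb with
  | one hb =>
    subst hPn
    exact hb.exists_on_isLev hM hP
  | succ _ hc ih =>
    obtain ⟨i, hi, rfl, hlev⟩ := ih
    obtain ⟨j, hj, hPj, hlev'⟩ := hc.exists_on_isLev hM (hP.take hi hlev)
    exact ⟨j, hj.trans hi, hPj, hlev'⟩

end Walks

end AltPath

theorem mainTheorem11 {V : Type*} [Finite V] [DecidableEq V] (G : SimpleGraph V)
    (M : G.Subgraph) (hM : M.IsMatching) (v : V) :
    -- the base is well defined: at every vertex of tenacity less than `l_m` there is a base
    (∀ u : V, AltPath.tenacity M u < AltPath.minAugLength M → ∃! b : V, AltPath.IsBase M u b) ∧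
    -- the iterated bases of `v` lie on every level path of `v`, BFS-honestly
    (∀ (k : ℕ) (b : V), AltPath.IsIteratedBase M v k b →
      ∀ (f : V) (p : G.Walk f v), AltPath.IsEvenlevelPath M p ∨ AltPath.IsOddlevelPath M p →
        ∃ hb : b ∈ p.support, AltPath.IsBFSHonest M p b hb) := by
  constructor
  · intro u hu
    obtain ⟨t, ht⟩ := AltPath.exists_tenacity_eq hu
    refine ⟨_, ⟨hu, AltPath.baseSet_eq hM ht hu⟩, fun c hc => ?_⟩
    have := hc.2
    rw [AltPath.baseSet_eq hM ht hu, Set.singleton_eq_singleton_iff] at this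
    exact this.symm
  · intro k b hb f p hp
    obtain ⟨-, -, hlev⟩ := AltPath.isLevelPath_iff.1 hp
    obtain ⟨i, hi, rfl, hbi⟩ := hb.exists_on_isLev hM hlev p.getVert_length
    refine ⟨p.getVert_mem_support i, fun he => ?_, fun ho => ?_⟩
    · rw [AltPath.length_takeUntil_eq hlev.1 hi _ rfl] at he ⊢
      rw [AltPath.lev, if_pos he] at hbi
      exact hbi.symm
    · rw [AltPath.length_takeUntil_eq hlev.1 hi _ rfl] at ho ⊢
      rw [AltPath.lev, if_neg (Nat.not_even_iff_odd.2 ho)] at hbi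
      exact hbi.symm
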